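/- Let $k$ be a field of characteristic zero and let $I$ be the identity matrix in $\mathrm{SL}(2)(k)$. For $\alpha\in\mathrm{SL}(2)(k)$ let $S_\alpha\subset \mathrm{SL}(2)\times\mathrm{SL}(2)$ be the closed subscheme over $k$ given by the matrix equation $XYX^{-1}Y^{-1}=\alpha$ (the commutator variety). A $k$-scheme of finite type is called $k$-rational of dimension $3$ if it is integral, birationally equivalent over $k$ to an affine space, and of dimension $3$. (i) If $-1$ is a sum of two squares in $k$, then $S_{-I}$ is $k$-rational of dimension $3$. Otherwise $S_{-I}$ has no $k$-points, that is, $S_{-I}(k)=\emptyset$, and $S_{-I}$ is not birationally equivalent over $k$ to any affine space. (ii) If $\alpha\in\mathrm{SL}(2)(k)$ is a non-central element such that $\mathrm{tr}(\alpha)=2$ or $\mathrm{tr}(\alpha)=-2$, then $S_\alpha$ is $k$-rational of dimension $3$. -/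

import Mathlib

open AlgebraicGeometry CategoryTheory MatrixGroups

noncomputable section

namespace CommutatorVariety

universe u

variable (k : Type u) [Field k]

/-- Polynomials in the eight matrix entries of a pair of `2 × 2` matrices; the variable `(0, i, j)`
is the `(i, j)` entry of the first matrix and `(1, i, j)` that of the second one. -/
abbrev EntryPoly : Type u := MvPolynomial (Fin 2 × Fin 2 × Fin 2) k

/-- The generic `2 × 2` matrices. -/
def genericMatrix (l : Fin 2) : Matrix (Fin 2) (Fin 2) (EntryPoly k) :=
  Matrix.of fun i j => MvPolynomial.X (l, i, j)

/-- The ideal of `SL(2) × SL(2)` in the affine space of pairs of matrices. -/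
def detIdeal : Ideal (EntryPoly k) :=
  Ideal.span (Set.range fun l : Fin 2 => (genericMatrix k l).det - 1)

/-- The coordinate ring of `SL(2) × SL(2)` over `k`. -/
abbrev CoordSL2Sq : Type u := EntryPoly k ⧸ detIdeal k

lemma det_map_genericMatrix (l : Fin 2) :
    ((genericMatrix k l).map (Ideal.Quotient.mk (detIdeal k))).det = 1 := by
  have h := (RingHom.map_det (Ideal.Quotient.mk (detIdeal k)) (genericMatrix k l)).symm
  rw [RingHom.mapMatrix_apply] at h
  rw [h, ← map_one (Ideal.Quotient.mk (detIdeal k)), Ideal.Quotient.eq]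
  exact Ideal.subset_span ⟨l, rfl⟩

/-- The universal elements `X` (for `l = 0`) and `Y` (for `l = 1`) of `SL(2)` over the coordinate
ring of `SL(2) × SL(2)`. -/
def universalElement (l : Fin 2) : SL(2, CoordSL2Sq k) :=
  ⟨(genericMatrix k l).map (Ideal.Quotient.mk (detIdeal k)), det_map_genericMatrix k l⟩

variable {k}

/-- The ideal of the closed subscheme of `SL(2) × SL(2)` given by the matrix equation
`X Y X⁻¹ Y⁻¹ = α`. -/
def commutatorIdeal (α : SL(2, k)) : Ideal (CoordSL2Sq k) :=
  Ideal.span (Set.range fun p : Fin 2 × Fin 2 =>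
    (universalElement k 0 * universalElement k 1 *
        (universalElement k 0)⁻¹ * (universalElement k 1)⁻¹) p.1 p.2 -
      algebraMap k (CoordSL2Sq k) (α p.1 p.2))

/-- The coordinate ring of the commutator variety. -/
abbrev CoordRing (α : SL(2, k)) : Type u := CoordSL2Sq k ⧸ commutatorIdeal α

/-- The commutator variety `S_α`, as a scheme. -/
def S (α : SL(2, k)) : Scheme.{u} := Spec (CommRingCat.of (CoordRing α))

/-- The structure morphism `S_α ⟶ Spec k`. -/
def structureMap (α : SL(2, k)) : S α ⟶ Spec (CommRingCat.of k) :=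
  Spec.map (CommRingCat.ofHom (algebraMap k (CoordRing α)))

/-- A `k`-scheme is a `k`-rational variety of dimension `d` if it is integral, birational over `k`
to an affine space, and has Krull dimension `d`. -/
structure IsRationalOfDim {X : Scheme.{u}} (s : X ⟶ Spec (CommRingCat.of k)) (d : ℕ) : Prop where
  isIntegral : IsIntegral X
  isRationalOver : Scheme.IsRationalOver s
  dim_eq : topologicalKrullDim X = d

/-- The set `X(k)` of `k`-points of a `k`-scheme: sections of the structure morphism. -/
abbrev RatPoint {X : Scheme.{u}} (s : X ⟶ Spec (CommRingCat.of k)) : Type u :=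
  {p : Spec (CommRingCat.of k) ⟶ X // p ≫ s = 𝟙 (Spec (CommRingCat.of k))}

end CommutatorVariety

end

/-!
Both matrices of a point of `S_α` are determined by three functions on a principal open subset, and
this identifies the subset with a principal open subset of affine space. Automorphisms of `S_α`
move the subset so that its translates cover `S_α`. The translates are then spectra of domains, and
they all contain the generic point of the first one; hence `S_α` is integral.

* If `tr α = 2`, then `α` is conjugate to a unipotent Jordan block, which forces `X` and `Y` to be
  upper triangular, and the equation becomes linear in one off-diagonal entry.
* If `tr α = -2`, then the traces of `X`, `Y` and `XY` satisfy Markov's equation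
  `x² + y² + z² = xyz`, whose surface is parametrized by the ratios `y / x` and `z / x`. Where
  the traces are invertible, the pair `(X, Y)` is determined by its traces and one further entry.
* If `α = -1`, then `X² = Y² = -1` and `XY = -YX`, so that a point of `S_α` is a two-dimensional
  representation of Hamilton's quaternions. If `-1 = u² + v²`, there is a standard one, and
  averaging a matrix unit over the quaternion group gives an intertwiner from it to `(X, Y)`. The
  ratios of the entries of the intertwiner are the coordinates: `S_α` is isomorphic to `PGL(2)`.
  Conversely, the entries of a `k`-point express `-1` as a sum of two squares, and over an infinite
  field a rational variety has a `k`-point.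
-/

namespace CommutatorVariety

universe u

section Cover

variable {A D : Type*} [CommRing A] [CommRing D] [IsDomain D]

lemma isDomain_localizationAway {g : D} (hg : g ≠ 0) : IsDomain (Localization.Away g) :=
  IsLocalization.isDomain_localization (powers_le_nonZeroDivisors_of_noZeroDivisors hg)

lemma exists_pow_mul_eq_zero_of_algebraMap_away_eq_zero {a x : A}
    (hx : algebraMap A (Localization.Away a) x = 0) : ∃ n : ℕ, a ^ n * x = 0 := by
  obtain ⟨⟨_, n, rfl⟩, hn⟩ :=
    (IsLocalization.map_eq_zero_iff (Submonoid.powers a) (Localization.Away a) x).1 hx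
  exact ⟨n, hn⟩

lemma injective_algebraMap_away_of_span_eq_top {s : Set A} (hs : Ideal.span s = ⊤)
    (hdom : ∀ a ∈ s, IsDomain (Localization.Away a)) (φ : A →+* D) (hφ : ∀ a ∈ s, φ a ≠ 0)
    {a : A} (ha : a ∈ s) : Function.Injective (algebraMap A (Localization.Away a)) := by
  refine (injective_iff_map_eq_zero _).2 fun x hx => ?_
  obtain ⟨n, hn⟩ := exists_pow_mul_eq_zero_of_algebraMap_away_eq_zero hx
  refine Module.eq_zero_of_isLocalized_span s hs (fun b => Localization.Away b.1)
    (fun b => Algebra.linearMap A (Localization.Away b.1)) x ?_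
  rintro ⟨b, hb⟩
  have := hdom b hb
  have hab : algebraMap A (Localization.Away b) a ≠ 0 := by
    intro h
    obtain ⟨m, hm⟩ := exists_pow_mul_eq_zero_of_algebraMap_away_eq_zero h
    have := congrArg φ hm
    rw [map_mul, map_pow, map_zero] at this
    exact mul_ne_zero (pow_ne_zero m (hφ b hb)) (hφ a ha) this
  have := congrArg (algebraMap A (Localization.Away b)) hn
  rw [map_mul, map_pow, map_zero] at this
  exact (mul_eq_zero.1 this).resolve_left (pow_ne_zero n hab)

lemma isDomain_of_span_eq_top {s : Set A} (hs : Ideal.span s = ⊤)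
    (hdom : ∀ a ∈ s, IsDomain (Localization.Away a)) (φ : A →+* D) (hφ : ∀ a ∈ s, φ a ≠ 0) :
    IsDomain A := by
  have : Nontrivial A := φ.domain_nontrivial
  obtain ⟨a, ha⟩ : s.Nonempty := by
    rw [Set.nonempty_iff_ne_empty]
    rintro rfl
    exact bot_ne_top (Ideal.span_empty.symm.trans hs)
  have := hdom a ha
  exact (injective_algebraMap_away_of_span_eq_top hs hdom φ hφ ha).isDomain _

end Cover

section Chart

open MvPolynomial

variable {k A : Type u} [CommRing k] [CommRing A] [Algebra k A] {n : ℕ}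

/-- The fractions `num i / den` identify the open subset `f ≠ 0` of `Spec A` with the open subset
`g ≠ 0` of affine space. This is expressed in terms of points with values in `k`-algebras, so that
it can be checked by computing with the points of `Spec A`. -/
structure IsChart (f den : A) (num : Fin n → A) (g : MvPolynomial (Fin n) k) : Prop where
  den_dvd : den ∣ f
  exists_point {R : Type u} [CommRing R] [Algebra k R] (x : Fin n → R) :
    IsUnit (aeval x g) → ∃ φ : A →ₐ[k] R, IsUnit (φ f) ∧ ∀ i, φ (num i) = x i * φ den
  isUnit_aeval {R : Type u} [CommRing R] [Algebra k R] (φ : A →ₐ[k] R) (x : Fin n → R) :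
    IsUnit (φ f) → (∀ i, φ (num i) = x i * φ den) → IsUnit (aeval x g)
  point_unique {R : Type u} [CommRing R] [Algebra k R] (φ ψ : A →ₐ[k] R) (x : Fin n → R) :
    IsUnit (φ f) → IsUnit (ψ f) → (∀ i, φ (num i) = x i * φ den) →
      (∀ i, ψ (num i) = x i * ψ den) → φ = ψ

lemma IsChart.nonempty_algEquiv_away {f den : A} {num : Fin n → A} {g : MvPolynomial (Fin n) k}
    (h : IsChart f den num g) : Nonempty (Localization.Away f ≃ₐ[k] Localization.Away g) := by
  let ι := IsScalarTower.toAlgHom k A (Localization.Away f)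
  let κ := IsScalarTower.toAlgHom k (MvPolynomial (Fin n) k) (Localization.Away g)
  have hι : IsUnit (ι f) := IsLocalization.Away.algebraMap_isUnit f
  have hκ : aeval (fun i => κ (X i)) = κ := algHom_ext fun i => aeval_X _ i
  obtain ⟨φ, hφ, hφnum⟩ := h.exists_point (fun i => κ (X i)) <| by
    rw [hκ]
    exact IsLocalization.Away.algebraMap_isUnit g
  choose v hv using fun i => (isUnit_of_dvd_unit (map_dvd ι h.den_dvd) hι).dvd (a := ι (num i))
  replace hv i : ι (num i) = v i * ι den := by rw [hv, mul_comm]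
  let Φ : Localization.Away f →ₐ[k] Localization.Away g :=
    IsLocalization.liftAlgHom (M := Submonoid.powers f) (f := φ) <| by
      rintro ⟨_, m, rfl⟩
      simpa using hφ.pow m
  let Ψ : Localization.Away g →ₐ[k] Localization.Away f :=
    IsLocalization.liftAlgHom (M := Submonoid.powers g) (f := aeval v) <| by
      rintro ⟨_, m, rfl⟩
      simpa using (h.isUnit_aeval ι v hι hv).pow m
  have hΦ (a : A) : Φ (ι a) = φ a := IsLocalization.lift_eq _ _
  have hΨ (i : Fin n) : Ψ (κ (X i)) = v i := (IsLocalization.lift_eq _ _).trans (aeval_X v i)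
  refine ⟨AlgEquiv.ofAlgHom Φ Ψ ?_ ?_⟩
  · refine IsLocalization.algHom_ext (Submonoid.powers g) (algHom_ext fun i => ?_)
    refine (isUnit_of_dvd_unit (map_dvd φ h.den_dvd) hφ).mul_right_cancel ?_
    calc Φ (Ψ (κ (X i))) * φ den = Φ (v i * ι den) := by rw [hΨ, map_mul, hΦ den]
      _ = κ (X i) * φ den := by rw [← hv, hΦ, hφnum]
  · have hΨφ : Ψ.comp φ = ι := h.point_unique _ _ v (hφ.map Ψ) hι
      (fun i => by simp only [AlgHom.comp_apply, hφnum, map_mul, hΨ]) hv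
    refine IsLocalization.algHom_ext (Submonoid.powers f) (AlgHom.ext fun a => ?_)
    change Ψ (Φ (ι a)) = ι a
    rw [hΦ]
    exact DFunLike.congr_fun hΨφ a

end Chart

section RationalDomain

variable {k A : Type*} [Field k] [CommRing A] [Algebra k A] {n : ℕ}

/-- The algebraic form of rationality of an affine `k`-scheme `Spec A`: the ring `A` is a domain
and some nonempty principal open of `Spec A` is isomorphic over `k` to a nonempty principal open of
affine `n`-space. -/
structure IsRationalDomain (k A : Type*) [Field k] [CommRing A] [Algebra k A] (n : ℕ) : Prop where
  isDomain : IsDomain A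
  exists_algEquiv_away : ∃ (f : A) (g : MvPolynomial (Fin n) k), f ≠ 0 ∧ g ≠ 0 ∧
    Nonempty (Localization.Away f ≃ₐ[k] Localization.Away g)

/-- The isomorphism between principal opens induced by an isomorphism of algebras. -/
noncomputable def awayEquiv {B : Type*} [CommRing B] [Algebra k B] (e : A ≃ₐ[k] B) (f : A) :
    Localization.Away f ≃ₐ[k] Localization.Away (e f) :=
  IsLocalization.algEquivOfAlgEquiv (M := Submonoid.powers f) (T := Submonoid.powers (e f))
    _ _ e (by simp)

lemma IsRationalDomain.of_algEquiv {B : Type*} [CommRing B] [Algebra k B]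
    (h : IsRationalDomain k A n) (e : A ≃ₐ[k] B) : IsRationalDomain k B n := by
  have := h.isDomain
  obtain ⟨f, g, hf, hg, ⟨c⟩⟩ := h.exists_algEquiv_away
  exact ⟨e.symm.toMulEquiv.isDomain _, e f, g, by simpa using hf, hg,
    ⟨(awayEquiv e f).symm.trans c⟩⟩

open MvPolynomial in
lemma IsChart.isRationalDomain {k A : Type u} [Field k] [CommRing A] [Algebra k A] {f den : A}
    {num : Fin n → A} {g : MvPolynomial (Fin n) k} (h : IsChart f den num g) (hg : g ≠ 0)
    {T : Set (A ≃ₐ[k] A)} (hT : Ideal.span ((fun τ => τ f) '' T) = ⊤)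
    (generic : ∀ {D : Type u} [CommRing D] [IsDomain D] [Algebra k D] (φ : A →ₐ[k] D)
      (x : Fin n → D), AlgebraicIndependent k x → IsUnit (φ f) →
        (∀ i, φ (num i) = x i * φ den) → ∀ τ ∈ T, φ (τ f) ≠ 0) : IsRationalDomain k A n := by
  obtain ⟨c⟩ := h.nonempty_algEquiv_away
  have := isDomain_localizationAway hg
  have isDomain_away : IsDomain (Localization.Away f) := c.toMulEquiv.isDomain _
  let κ :=
    IsScalarTower.toAlgHom k (MvPolynomial (Fin n) k) (FractionRing (MvPolynomial (Fin n) k))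
  have hκ : aeval (fun i => κ (X i)) = κ := algHom_ext fun i => aeval_X _ i
  have independent : AlgebraicIndependent k fun i => κ (X i) := by
    rw [algebraicIndependent_iff_injective_aeval, hκ]
    exact IsFractionRing.injective _ _
  obtain ⟨φ, hφ, hφnum⟩ := h.exists_point _ (IsUnit.mk0 _ ((map_ne_zero_iff _ independent).2 hg))
  refine ⟨isDomain_of_span_eq_top hT ?_ φ.toRingHom
    (Set.forall_mem_image.2 (generic φ _ independent hφ hφnum)), f, g, ?_, hg, ⟨c⟩⟩
  · rintro _ ⟨τ, -, rfl⟩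
    exact (awayEquiv τ f).symm.toMulEquiv.isDomain _
  · rintro rfl
    exact not_subsingleton _ (IsLocalization.subsingleton (M := Submonoid.powers (0 : A))
      (S := Localization.Away (0 : A)) ⟨1, pow_one 0⟩)

end RationalDomain

section Dimension

lemma ringKrullDim_eq_of_isIntegral (R S : Type*) [CommRing R] [CommRing S] [Algebra R S]
    [Algebra.IsIntegral R S] [FaithfulSMul R S] : ringKrullDim S = ringKrullDim R := by
  apply le_antisymm
  · exact Order.krullDim_le_of_strictMono (PrimeSpectrum.comap (algebraMap R S)) fun p q h =>
      Ideal.IsIntegral.comap_lt_comap (R := R) (I := p.asIdeal) (J := q.asIdeal) h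
  · refine iSup_le fun l => ?_
    have ker_le : (⊥ : Ideal S).comap (algebraMap R S) ≤ l.head.asIdeal := by
      rw [← RingHom.ker_eq_comap_bot, (RingHom.injective_iff_ker_eq_bot _).1
        (FaithfulSMul.algebraMap_injective R S)]
      exact bot_le
    obtain ⟨Q, -, hQ_prime, hQ⟩ :=
      Ideal.exists_ideal_over_prime_of_isIntegral (S := S) l.head.asIdeal ⊥ ker_le
    have : Q.LiesOver l.head.asIdeal := ⟨hQ.symm⟩
    obtain ⟨m, hm, -⟩ := Ideal.exists_ltSeries_of_hasGoingUp l Q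
    rw [← hm]
    exact le_iSup (fun l : LTSeries (PrimeSpectrum S) => (l.length : WithBot ℕ∞)) m

open Cardinal in
lemma ringKrullDim_eq_of_trdeg_eq (k A : Type*) [Field k] [CommRing A] [IsDomain A] [Algebra k A]
    [Algebra.FiniteType k A] {d : ℕ} (hd : Algebra.trdeg k A = d) : ringKrullDim A = d := by
  obtain ⟨s, g, hg_inj, hg_int⟩ := exists_integral_inj_algHom_of_fg k A
  algebraize [g.toRingHom]
  have : Algebra.IsIntegral (MvPolynomial (Fin s) k) A := ⟨hg_int⟩
  have : FaithfulSMul (MvPolynomial (Fin s) k) A :=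
    (faithfulSMul_iff_algebraMap_injective _ _).2 hg_inj
  have : IsScalarTower k (MvPolynomial (Fin s) k) A :=
    IsScalarTower.of_algebraMap_eq fun r => (g.commutes r).symm
  have hs : s = d := by
    have := lift_trdeg_add_eq k (MvPolynomial (Fin s) k) A
    rw [hd, trdeg_eq_zero (R := MvPolynomial (Fin s) k) (A := A)] at this
    simpa using this
  rw [ringKrullDim_eq_of_isIntegral (MvPolynomial (Fin s) k) A, ← hs]
  simp

lemma trdeg_localizationAway {k A : Type*} [CommRing k] [IsDomain k] [CommRing A] [IsDomain A]
    [Algebra k A] [FaithfulSMul k A] {f : A} (hf : f ≠ 0) :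
    Algebra.trdeg k (Localization.Away f) = Algebra.trdeg k A := by
  have hle := powers_le_nonZeroDivisors_of_noZeroDivisors hf
  have := isDomain_localizationAway hf
  have : FaithfulSMul A (Localization.Away f) :=
    (faithfulSMul_iff_algebraMap_injective _ _).2 (IsLocalization.injective _ hle)
  have : Algebra.IsAlgebraic A (Localization.Away f) :=
    IsLocalization.isAlgebraic _ (Submonoid.powers f)
  have htower := trdeg_add_eq k A (A := Localization.Away f)
  rw [trdeg_eq_zero (R := A), add_zero] at htower
  exact htower.symm

lemma IsRationalDomain.ringKrullDim_eq {k A : Type*} [Field k] [CommRing A] [Algebra k A]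
    [Algebra.FiniteType k A] {n : ℕ} (h : IsRationalDomain k A n) : ringKrullDim A = n := by
  have := h.isDomain
  obtain ⟨f, g, hf, hg, ⟨e⟩⟩ := h.exists_algEquiv_away
  apply ringKrullDim_eq_of_trdeg_eq k
  have := e.lift_trdeg_eq
  rw [trdeg_localizationAway hf, trdeg_localizationAway hg] at this
  simpa using this

end Dimension

section Geometry

variable {k : Type u} [Field k]

lemma isDominant_specMap_away {A : Type u} [CommRing A] [IsDomain A] {f : A} (hf : f ≠ 0) :
    IsDominant (Spec.map (CommRingCat.ofHom (algebraMap A (Localization.Away f)))) := by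
  refine ⟨(PrimeSpectrum.denseRange_comap_iff_ker_le_nilRadical
    (algebraMap A (Localization.Away f))).2 ?_⟩
  rw [(RingHom.injective_iff_ker_eq_bot _).1
    (IsLocalization.injective _ (powers_le_nonZeroDivisors_of_noZeroDivisors hf))]
  exact bot_le

lemma birationalOver_away {A : Type u} [CommRing A] [IsDomain A] [Algebra k A] {f : A}
    (hf : f ≠ 0) : Scheme.BirationalOver
      (Spec.map (CommRingCat.ofHom (algebraMap k (Localization.Away f))))
      (Spec.map (CommRingCat.ofHom (algebraMap k A))) := by
  have := isDominant_specMap_away hf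
  refine Scheme.Hom.birationalOver
    (Spec.map (CommRingCat.ofHom (algebraMap A (Localization.Away f)))) _ _ ?_
  rw [← Spec.map_comp, ← CommRingCat.ofHom_comp, ← IsScalarTower.algebraMap_eq]

lemma birationalOver_of_algEquiv {A B : Type u} [CommRing A] [Algebra k A] [CommRing B]
    [Algebra k B] (e : A ≃ₐ[k] B) : Scheme.BirationalOver
      (Spec.map (CommRingCat.ofHom (algebraMap k A)))
      (Spec.map (CommRingCat.ofHom (algebraMap k B))) := by
  have : IsIso (CommRingCat.ofHom (e.symm : B →+* A)) :=
    inferInstanceAs (IsIso e.symm.toRingEquiv.toCommRingCatIso.hom)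
  refine Scheme.Hom.birationalOver (Spec.map (CommRingCat.ofHom (e.symm : B →+* A))) _ _ ?_
  rw [← Spec.map_comp, ← CommRingCat.ofHom_comp]
  congr 2
  ext x
  simp

lemma IsRationalDomain.isRationalOver {A : Type u} [CommRing A] [Algebra k A] {n : ℕ}
    (h : IsRationalDomain k A n) :
    Scheme.IsRationalOver (Spec.map (CommRingCat.ofHom (algebraMap k A))) := by
  have := h.isDomain
  obtain ⟨f, g, hf, hg, ⟨e⟩⟩ := h.exists_algEquiv_away
  let r := MvPolynomial.renameEquiv k (Equiv.ulift.{u} (α := Fin n)).symm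
  have affineSpace := Scheme.Hom.birationalOver
    (AffineSpace.SpecIso (ULift (Fin n)) (.of k)).inv _ _ (AffineSpace.SpecIso_inv_over _)
  exact ⟨ULift (Fin n), (birationalOver_away hf).symm.trans <|
    (birationalOver_of_algEquiv e).trans <| (birationalOver_away hg).trans <|
    (birationalOver_of_algEquiv r).trans affineSpace⟩

lemma IsRationalDomain.isRationalOfDim {α : SL(2, k)} {n : ℕ}
    (h : IsRationalDomain k (CoordRing α) n) : IsRationalOfDim (structureMap α) n where
  isIntegral := by
    have := h.isDomain
    exact inferInstanceAs (IsIntegral (Spec (CommRingCat.of (CoordRing α))))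
  isRationalOver := h.isRationalOver
  dim_eq := by
    rw [← h.ringKrullDim_eq]
    exact PrimeSpectrum.topologicalKrullDim_eq_ringKrullDim (CoordRing α)

lemma exists_section_mem_of_affineSpace [Infinite k] {n : Type u}
    {U : 𝔸(n; Spec (CommRingCat.of k)).Opens}
    (hU : (U : Set 𝔸(n; Spec (CommRingCat.of k))).Nonempty) :
    ∃ q : Spec (CommRingCat.of k) ⟶ 𝔸(n; Spec (CommRingCat.of k)),
      q ≫ (𝔸(n; Spec (CommRingCat.of k)) ↘ Spec (CommRingCat.of k)) = 𝟙 _ ∧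
        Set.range q ⊆ U := by
  obtain ⟨x, hx⟩ := hU
  let i := AffineSpace.SpecIso n (CommRingCat.of k)
  have hx' : i.hom x ∈ i.inv ⁻¹ᵁ U := by
    change i.inv (i.hom x) ∈ U
    simpa using hx
  obtain ⟨_, ⟨_, ⟨g, rfl⟩, rfl⟩, hxg, hgU⟩ :=
    PrimeSpectrum.isBasis_basic_opens.exists_subset_of_mem_open
      (SetLike.mem_coe.2 hx') (i.inv ⁻¹ᵁ U).isOpen
  have hg : g ≠ 0 := by
    rintro rfl
    exact hxg (Ideal.zero_mem _)
  obtain ⟨v, hv⟩ : ∃ v : n → k, MvPolynomial.eval v g ≠ 0 := by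
    by_contra! hv
    exact hg (MvPolynomial.funext fun v => by simpa using hv v)
  refine ⟨Spec.map (CommRingCat.ofHom (MvPolynomial.eval v)) ≫ i.inv, ?_, ?_⟩
  · rw [Category.assoc, AffineSpace.SpecIso_inv_over, ← Spec.map_comp, ← Spec.map_id]
    congr 1
    ext x
    simp
  · rintro _ ⟨y, rfl⟩
    refine hgU (a := Spec.map (CommRingCat.ofHom (MvPolynomial.eval v)) y) fun hmem => ?_
    have hy : MvPolynomial.eval v g ∈ PrimeSpectrum.asIdeal y := hmem
    exact y.2.ne_top (Ideal.eq_top_of_isUnit_mem _ hy (IsUnit.mk0 _ hv))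

lemma nonempty_ratPoint_of_isRationalOver [Infinite k] {X : Scheme.{u}}
    {s : X ⟶ Spec (CommRingCat.of k)} (h : Scheme.IsRationalOver s) : Nonempty (RatPoint s) := by
  obtain ⟨n, e, he⟩ := h.exists_birationalOver_affineSpace
  obtain ⟨x, hx⟩ := e.dense_target.nonempty
  obtain ⟨q, hq, hqU⟩ := exists_section_mem_of_affineSpace ⟨x, hx⟩
  have hr : Set.range q ⊆ Set.range e.target.ι := by rwa [Scheme.Opens.range_ι]
  have over_base : e.iso.inv ≫ e.source.ι ≫ s =
      e.target.ι ≫ (𝔸(n; Spec (CommRingCat.of k)) ↘ _) := by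
    rw [Iso.inv_comp_eq]
    exact Eq.symm he
  refine ⟨⟨IsOpenImmersion.lift e.target.ι q hr ≫ e.iso.inv ≫ e.source.ι, ?_⟩⟩
  rw [Category.assoc, Category.assoc, over_base, IsOpenImmersion.lift_fac_assoc, hq]

end Geometry

section Points

open Matrix
open scoped commutatorElement

variable {k : Type u} [Field k] (α : SL(2, k))

/-- The coordinate ring of `S_α`, sealed so that unification of instances does not unfold the
iterated quotient. -/
def Coord : Type u := CoordRing α

noncomputable instance : CommRing (Coord α) :=
  inferInstanceAs (CommRing (CoordRing α))

noncomputable instance : Algebra k (Coord α) :=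
  inferInstanceAs (Algebra k (CoordRing α))

/-- The tautological isomorphism between the two forms of the coordinate ring. -/
noncomputable def coordEquiv : Coord α ≃ₐ[k] CoordRing α where
  __ := RingEquiv.refl (CoordRing α)
  commutes' _ := rfl

/-- The restriction of functions from `SL(2) × SL(2)` to `S_α`. -/
noncomputable def toCoord : CoordSL2Sq k →ₐ[k] Coord α where
  __ := Ideal.Quotient.mk (commutatorIdeal α)
  commutes' _ := rfl

/-- The first matrix of the universal point of `S_α`. -/
noncomputable def univX : SL(2, Coord α) :=
  SpecialLinearGroup.map (toCoord α : CoordSL2Sq k →+* Coord α) (universalElement k 0)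

/-- The second matrix of the universal point of `S_α`. -/
noncomputable def univY : SL(2, Coord α) :=
  SpecialLinearGroup.map (toCoord α : CoordSL2Sq k →+* Coord α) (universalElement k 1)

lemma commutator_univX_univY :
    ⁅univX α, univY α⁆ = SpecialLinearGroup.map (algebraMap k (Coord α)) α := by
  simp only [univX, univY, ← map_commutatorElement]
  ext i j
  exact Ideal.Quotient.eq.2 (Ideal.subset_span ⟨(i, j), rfl⟩)

variable {α} {R : Type*} [CommRing R] [Algebra k R]

/-- The first matrix of the `R`-point of `S_α` given by `φ`. -/
noncomputable def pointX (φ : Coord α →ₐ[k] R) : SL(2, R) :=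
  SpecialLinearGroup.map (φ : Coord α →+* R) (univX α)

/-- The second matrix of the `R`-point of `S_α` given by `φ`. -/
noncomputable def pointY (φ : Coord α →ₐ[k] R) : SL(2, R) :=
  SpecialLinearGroup.map (φ : Coord α →+* R) (univY α)

lemma commutator_pointX_pointY (φ : Coord α →ₐ[k] R) :
    ⁅pointX φ, pointY φ⁆ = SpecialLinearGroup.map (algebraMap k R) α := by
  rw [pointX, pointY, ← map_commutatorElement, commutator_univX_univY]
  ext i j
  exact φ.commutes _

lemma point_ext {φ ψ : Coord α →ₐ[k] R} (hX : pointX φ = pointX ψ)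
    (hY : pointY φ = pointY ψ) : φ = ψ := by
  have h : φ.comp (toCoord α) = ψ.comp (toCoord α) := by
    refine Ideal.Quotient.algHom_ext _ (MvPolynomial.algHom_ext ?_)
    rintro ⟨l, i, j⟩
    fin_cases l
    exacts [congrArg (fun M : SL(2, R) => M i j) hX, congrArg (fun M : SL(2, R) => M i j) hY]
  refine AlgHom.ext fun x => ?_
  obtain ⟨y, rfl⟩ := Ideal.Quotient.mk_surjective x
  exact DFunLike.congr_fun h y

/-- The homomorphism from the coordinate ring of `SL(2) × SL(2)` given by a pair of matrices. -/
noncomputable def pairHom (X : Fin 2 → SL(2, R)) : CoordSL2Sq k →ₐ[k] R :=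
  Ideal.Quotient.liftₐ (detIdeal k) (MvPolynomial.aeval fun p => X p.1 p.2.1 p.2.2) <| by
    change detIdeal k ≤ RingHom.ker _
    refine Ideal.span_le.2 ?_
    rintro _ ⟨l, rfl⟩
    have := (X l).det_coe
    rw [det_fin_two] at this
    simp [genericMatrix, det_fin_two, RingHom.mem_ker, this]

lemma pairHom_universalElement (X : Fin 2 → SL(2, R)) (l i j : Fin 2) :
    pairHom (k := k) X (universalElement k l i j) = X l i j :=
  MvPolynomial.aeval_X (fun p : Fin 2 × Fin 2 × Fin 2 => X p.1 p.2.1 p.2.2) (l, i, j)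

lemma map_pairHom_universalElement (X : Fin 2 → SL(2, R)) (l : Fin 2) :
    SpecialLinearGroup.map (pairHom (k := k) X : CoordSL2Sq k →+* R) (universalElement k l) =
      X l := by
  ext i j
  exact pairHom_universalElement X l i j

lemma commutatorIdeal_le_ker_pairHom {X Y : SL(2, R)}
    (h : ⁅X, Y⁆ = SpecialLinearGroup.map (algebraMap k R) α) :
    commutatorIdeal α ≤ RingHom.ker (pairHom ![X, Y] : CoordSL2Sq k →ₐ[k] R) := by
  refine Ideal.span_le.2 ?_
  rintro _ ⟨⟨i, j⟩, rfl⟩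
  have hcomm : SpecialLinearGroup.map (pairHom ![X, Y] : CoordSL2Sq k →ₐ[k] R).toRingHom
      ⁅universalElement k 0, universalElement k 1⁆ =
        SpecialLinearGroup.map (algebraMap k R) α := by
    rw [map_commutatorElement]
    exact (congrArg₂ _ (map_pairHom_universalElement _ 0)
      (map_pairHom_universalElement _ 1)).trans h
  refine (map_sub (pairHom ![X, Y]) _ _).trans (sub_eq_zero.2 ?_)
  exact (congrArg (fun M : SL(2, R) => M i j) hcomm).trans ((pairHom ![X, Y]).commutes _).symm

/-- The `R`-point of `S_α` given by a pair of matrices with commutator `α`. -/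
noncomputable def point (X Y : SL(2, R))
    (h : ⁅X, Y⁆ = SpecialLinearGroup.map (algebraMap k R) α) : Coord α →ₐ[k] R :=
  (Ideal.Quotient.liftₐ (commutatorIdeal α) (pairHom ![X, Y])
    fun _ ha => commutatorIdeal_le_ker_pairHom h ha).comp (coordEquiv α).toAlgHom

lemma point_toCoord (X Y : SL(2, R)) (h) (x : CoordSL2Sq k) :
    point (α := α) X Y h (toCoord α x) = pairHom ![X, Y] x :=
  Ideal.Quotient.lift_mk (commutatorIdeal α) _ fun _ ha => commutatorIdeal_le_ker_pairHom h ha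

@[simp] lemma pointX_point (X Y : SL(2, R)) (h) : pointX (point (α := α) X Y h) = X := by
  ext i j
  exact (point_toCoord X Y h (universalElement k 0 i j)).trans
    (pairHom_universalElement ![X, Y] 0 i j)

@[simp] lemma pointY_point (X Y : SL(2, R)) (h) : pointY (point (α := α) X Y h) = Y := by
  ext i j
  exact (point_toCoord X Y h (universalElement k 1 i j)).trans
    (pairHom_universalElement ![X, Y] 1 i j)

lemma point_univX (X Y : SL(2, R)) (h) (i j : Fin 2) :
    point (α := α) X Y h (univX α i j) = X i j :=
  congrArg (fun M : SL(2, R) => M i j) (pointX_point X Y h)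

lemma point_univY (X Y : SL(2, R)) (h) (i j : Fin 2) :
    point (α := α) X Y h (univY α i j) = Y i j :=
  congrArg (fun M : SL(2, R) => M i j) (pointY_point X Y h)

end Points

section Conjugation

open Matrix

variable {n : Type*} [Fintype n] [DecidableEq n] {R : Type*} [CommRing R]

/-- Conjugation of the special linear group by an element of the general linear group. -/
noncomputable def conjGL (P : GL n R) : SpecialLinearGroup n R →* SpecialLinearGroup n R where
  toFun X := ⟨P.1 * X.1 * P⁻¹.1, by
    rw [det_mul_right_comm, ← Units.val_mul, mul_inv_cancel, Units.val_one, one_mul, X.2]⟩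
  map_one' := Subtype.ext (by simp)
  map_mul' X Y := Subtype.ext (by
    change P.1 * (X.1 * Y.1) * P⁻¹.1 = P.1 * X.1 * P⁻¹.1 * (P.1 * Y.1 * P⁻¹.1)
    simp [mul_assoc])

lemma coe_conjGL (P : GL n R) (X : SpecialLinearGroup n R) :
    (conjGL P X).1 = P.1 * X.1 * P⁻¹.1 := rfl

lemma conjGL_eq_iff {P : GL n R} {X Y : SpecialLinearGroup n R} :
    conjGL P X = Y ↔ P.1 * X.1 = Y.1 * P.1 := by
  rw [← Units.mul_inv_eq_iff_eq_mul, ← coe_conjGL]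
  exact Subtype.ext_iff

lemma conjGL_inv_conjGL (P : GL n R) (X : SpecialLinearGroup n R) :
    conjGL P⁻¹ (conjGL P X) = X :=
  Subtype.ext (by simp [coe_conjGL, mul_assoc])

lemma conjGL_conjGL_inv (P : GL n R) (X : SpecialLinearGroup n R) :
    conjGL P (conjGL P⁻¹ X) = X :=
  Subtype.ext (by simp [coe_conjGL, mul_assoc])

lemma map_conjGL {S : Type*} [CommRing S] (f : R →+* S) (P : GL n R)
    (X : SpecialLinearGroup n R) : SpecialLinearGroup.map f (conjGL P X) =
      conjGL (GeneralLinearGroup.map f P) (SpecialLinearGroup.map f X) := by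
  refine Subtype.ext ?_
  rw [coe_conjGL, ← map_inv]
  change f.mapMatrix (P.1 * X.1 * P⁻¹.1) = f.mapMatrix P.1 * f.mapMatrix X.1 * f.mapMatrix P⁻¹.1
  rw [map_mul, map_mul]

end Conjugation

section Symmetries

open Matrix
open scoped commutatorElement

variable {k : Type u} [Field k] {α β : SL(2, k)} {R S : Type*} [CommRing R] [Algebra k R]
  [CommRing S] [Algebra k S]

lemma pointX_comp (ψ : R →ₐ[k] S) (φ : Coord α →ₐ[k] R) :
    pointX (ψ.comp φ) = SpecialLinearGroup.map (ψ : R →+* S) (pointX φ) := rfl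

lemma pointY_comp (ψ : R →ₐ[k] S) (φ : Coord α →ₐ[k] R) :
    pointY (ψ.comp φ) = SpecialLinearGroup.map (ψ : R →+* S) (pointY φ) := rfl

lemma pointX_id : pointX (AlgHom.id k (Coord α)) = univX α := rfl

lemma pointY_id : pointY (AlgHom.id k (Coord α)) = univY α := rfl

/-- The morphism `(X, Y) ↦ (P X P⁻¹, P Y P⁻¹)` from `S_α` to the commutator variety of
`P α P⁻¹`. -/
noncomputable def conjHom (P : GL (Fin 2) k) (h : conjGL P α = β) :
    Coord β →ₐ[k] Coord α :=
  point (conjGL (GeneralLinearGroup.map (algebraMap k _) P) (univX α))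
    (conjGL (GeneralLinearGroup.map (algebraMap k _) P) (univY α)) <| by
      rw [← map_commutatorElement, commutator_univX_univY, ← map_conjGL, h]

lemma map_algHom_algebraMap (φ : R →ₐ[k] S) (P : GL (Fin 2) k) :
    GeneralLinearGroup.map (φ : R →+* S) (GeneralLinearGroup.map (algebraMap k R) P) =
      GeneralLinearGroup.map (algebraMap k S) P := by
  ext i j
  exact φ.commutes _

lemma pointX_comp_conjHom (φ : Coord α →ₐ[k] R) (P : GL (Fin 2) k) (h : conjGL P α = β) :
    pointX (φ.comp (conjHom P h)) =
      conjGL (GeneralLinearGroup.map (algebraMap k R) P) (pointX φ) := by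
  rw [pointX_comp, conjHom, pointX_point, map_conjGL, map_algHom_algebraMap]
  rfl

lemma pointY_comp_conjHom (φ : Coord α →ₐ[k] R) (P : GL (Fin 2) k) (h : conjGL P α = β) :
    pointY (φ.comp (conjHom P h)) =
      conjGL (GeneralLinearGroup.map (algebraMap k R) P) (pointY φ) := by
  rw [pointY_comp, conjHom, pointY_point, map_conjGL, map_algHom_algebraMap]
  rfl

/-- Conjugate elements have isomorphic commutator varieties. -/
noncomputable def conjEquiv (P : GL (Fin 2) k) (h : conjGL P α = β) :
    Coord β ≃ₐ[k] Coord α :=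
  AlgEquiv.ofAlgHom (conjHom P h) (conjHom P⁻¹ (by rw [← h, conjGL_inv_conjGL]))
    (point_ext
      (by rw [pointX_comp_conjHom, ← (conjHom P h).id_comp, pointX_comp_conjHom, map_inv,
        conjGL_inv_conjGL])
      (by rw [pointY_comp_conjHom, ← (conjHom P h).id_comp, pointY_comp_conjHom, map_inv,
        conjGL_inv_conjGL]))
    (point_ext
      (by rw [pointX_comp_conjHom, ← (conjHom P⁻¹ _).id_comp, pointX_comp_conjHom, map_inv,
        conjGL_conjGL_inv])
      (by rw [pointY_comp_conjHom, ← (conjHom P⁻¹ _).id_comp, pointY_comp_conjHom, map_inv,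
        conjGL_conjGL_inv]))

lemma commutator_mul_self_right {G : Type*} [Group G] (x y : G) : ⁅x, y * x⁆ = ⁅x, y⁆ := by
  group

lemma commutator_mul_self_left {G : Type*} [Group G] (x y : G) : ⁅x * y, y⁆ = ⁅x, y⁆ := by
  group

variable (α)

/-- The automorphism `(X, Y) ↦ (X, Y X)` of `S_α`, with inverse `(X, Y) ↦ (X, Y X⁻¹)`. -/
noncomputable def twistRight : Coord α ≃ₐ[k] Coord α :=
  AlgEquiv.ofAlgHom
    (point (univX α) (univY α * univX α)
      ((commutator_mul_self_right _ _).trans (commutator_univX_univY α)))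
    (point (univX α) (univY α * (univX α)⁻¹) (by rw [← commutator_univX_univY]; group))
    (point_ext
      (by rw [pointX_comp, pointX_point]; exact pointX_point _ _ _)
      (by
        rw [pointY_comp, pointY_point, map_mul, map_inv]
        change pointY _ * (pointX _)⁻¹ = univY α
        rw [pointX_point, pointY_point, mul_inv_cancel_right]))
    (point_ext
      (by rw [pointX_comp, pointX_point]; exact pointX_point _ _ _)
      (by
        rw [pointY_comp, pointY_point, map_mul]
        change pointY _ * pointX _ = univY α
        rw [pointX_point, pointY_point, inv_mul_cancel_right]))

/-- The automorphism `(X, Y) ↦ (X Y, Y)` of `S_α`, with inverse `(X, Y) ↦ (X Y⁻¹, Y)`. -/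
noncomputable def twistLeft : Coord α ≃ₐ[k] Coord α :=
  AlgEquiv.ofAlgHom
    (point (univX α * univY α) (univY α)
      ((commutator_mul_self_left _ _).trans (commutator_univX_univY α)))
    (point (univX α * (univY α)⁻¹) (univY α) (by rw [← commutator_univX_univY]; group))
    (point_ext
      (by
        rw [pointX_comp, pointX_point, map_mul, map_inv]
        change pointX _ * (pointY _)⁻¹ = univX α
        rw [pointX_point, pointY_point, mul_inv_cancel_right])
      (by rw [pointY_comp, pointY_point]; exact pointY_point _ _ _))
    (point_ext
      (by
        rw [pointX_comp, pointX_point, map_mul]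
        change pointX _ * pointY _ = univX α
        rw [pointX_point, pointY_point, inv_mul_cancel_right])
      (by rw [pointY_comp, pointY_point]; exact pointY_point _ _ _))

variable {α}

lemma pointX_comp_twistRight (φ : Coord α →ₐ[k] R) :
    pointX (φ.comp (twistRight α : Coord α →ₐ[k] Coord α)) = pointX φ := by
  rw [twistRight, AlgEquiv.toAlgHom_ofAlgHom, pointX_comp, pointX_point]
  rfl

lemma pointY_comp_twistRight (φ : Coord α →ₐ[k] R) :
    pointY (φ.comp (twistRight α : Coord α →ₐ[k] Coord α)) = pointY φ * pointX φ := by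
  rw [twistRight, AlgEquiv.toAlgHom_ofAlgHom, pointY_comp, pointY_point, map_mul]
  rfl

lemma pointX_comp_twistRight_symm (φ : Coord α →ₐ[k] R) :
    pointX (φ.comp ((twistRight α).symm : Coord α →ₐ[k] Coord α)) = pointX φ := by
  rw [twistRight, AlgEquiv.ofAlgHom_symm, AlgEquiv.toAlgHom_ofAlgHom, pointX_comp, pointX_point]
  rfl

lemma pointY_comp_twistRight_symm (φ : Coord α →ₐ[k] R) :
    pointY (φ.comp ((twistRight α).symm : Coord α →ₐ[k] Coord α)) = pointY φ * (pointX φ)⁻¹ := by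
  rw [twistRight, AlgEquiv.ofAlgHom_symm, AlgEquiv.toAlgHom_ofAlgHom, pointY_comp, pointY_point,
    map_mul, map_inv]
  rfl

lemma pointX_comp_twistLeft (φ : Coord α →ₐ[k] R) :
    pointX (φ.comp (twistLeft α : Coord α →ₐ[k] Coord α)) = pointX φ * pointY φ := by
  rw [twistLeft, AlgEquiv.toAlgHom_ofAlgHom, pointX_comp, pointX_point, map_mul]
  rfl

lemma pointY_comp_twistLeft (φ : Coord α →ₐ[k] R) :
    pointY (φ.comp (twistLeft α : Coord α →ₐ[k] Coord α)) = pointY φ := by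
  rw [twistLeft, AlgEquiv.toAlgHom_ofAlgHom, pointY_comp, pointY_point]
  rfl

end Symmetries

section Entries

open Matrix
open scoped commutatorElement

variable {R S : Type*} [CommRing R] [CommRing S]

lemma isUnit_two {k : Type*} [Field k] [Algebra k R] (h2 : (2 : k) ≠ 0) : IsUnit (2 : R) := by
  rw [← map_ofNat (algebraMap k R) 2]
  exact h2.isUnit.map _

lemma det_entries (X : SL(2, R)) : X 0 0 * X 1 1 - X 0 1 * X 1 0 = 1 := by
  rw [← det_fin_two X.1, X.2]

lemma eq_of_entries {X Y : SL(2, R)} (h₀₀ : X 0 0 = Y 0 0) (h₀₁ : X 0 1 = Y 0 1)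
    (h₁₀ : X 1 0 = Y 1 0) (h₁₁ : X 1 1 = Y 1 1) : X = Y := by
  ext i j
  fin_cases i <;> fin_cases j <;> assumption

lemma mul_entry (X Y : SL(2, R)) (i j : Fin 2) :
    (X * Y) i j = X i 0 * Y 0 j + X i 1 * Y 1 j :=
  (Matrix.mul_apply (M := X.1) (N := Y.1)).trans (Fin.sum_univ_two _)

lemma commutator_eq_iff {G : Type*} [Group G] {x y a : G} : ⁅x, y⁆ = a ↔ x * y = a * (y * x) := by
  rw [commutatorElement_def, mul_inv_eq_iff_eq_mul, mul_inv_eq_iff_eq_mul, mul_assoc]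

/-- The Jordan block with eigenvalue `ε`, scaled off the diagonal by `m`, where `ε ^ 2 = 1`. -/
def jordan (ε m : R) (h : ε * ε = 1) : SL(2, R) :=
  ⟨!![ε, m; 0, ε], by rw [det_fin_two_of, h, mul_zero, sub_zero]⟩

lemma map_jordan (f : R →+* S) (ε m : R) (h : ε * ε = 1) :
    SpecialLinearGroup.map f (jordan ε m h) =
      jordan (f ε) (f m) (by rw [← map_mul, h, map_one]) :=
  eq_of_entries rfl rfl (map_zero f) rfl

lemma commutator_eq_jordan_iff {X Y : SL(2, R)} {ε m : R} {h : ε * ε = 1} :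
    ⁅X, Y⁆ = jordan ε m h ↔
      X 0 0 * Y 0 0 + X 0 1 * Y 1 0 =
        ε * (Y 0 0 * X 0 0 + Y 0 1 * X 1 0) + m * (Y 1 0 * X 0 0 + Y 1 1 * X 1 0) ∧
      X 0 0 * Y 0 1 + X 0 1 * Y 1 1 =
        ε * (Y 0 0 * X 0 1 + Y 0 1 * X 1 1) + m * (Y 1 0 * X 0 1 + Y 1 1 * X 1 1) ∧
      X 1 0 * Y 0 0 + X 1 1 * Y 1 0 = ε * (Y 1 0 * X 0 0 + Y 1 1 * X 1 0) ∧
      X 1 0 * Y 0 1 + X 1 1 * Y 1 1 = ε * (Y 1 0 * X 0 1 + Y 1 1 * X 1 1) := by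
  rw [commutator_eq_iff, Matrix.SpecialLinearGroup.ext_iff]
  simp only [Fin.forall_fin_two, mul_entry, and_assoc]
  simp [jordan]

lemma exists_conjGL_jordan {k : Type*} [Field k] {α : SL(2, k)}
    (hα : α ∉ Subgroup.center SL(2, k)) {ε m : k} (hε : ε * ε = 1) (hm : m ≠ 0)
    (htr : α.1.trace = 2 * ε) : ∃ P : GL (Fin 2) k, conjGL P (jordan ε m hε) = α := by
  have htr' : α 0 0 + α 1 1 = 2 * ε := by rw [← htr, trace_fin_two]
  have hdet := det_entries α
  suffices ∃ P : Matrix (Fin 2) (Fin 2) k, P.det ≠ 0 ∧ P * !![ε, m; 0, ε] = α.1 * P by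
    obtain ⟨P, hP, h⟩ := this
    exact ⟨GeneralLinearGroup.mkOfDetNeZero P hP, conjGL_eq_iff.2 h⟩
  have hsq : (α 0 0 - ε) ^ 2 = -(α 0 1 * α 1 0) := by
    linear_combination α 0 0 * htr' - hdet + hε
  by_cases h₁₀ : α 1 0 = 0
  · have h₀₀ : α 0 0 = ε := by
      rw [h₁₀, mul_zero, neg_zero] at hsq
      exact sub_eq_zero.1 (pow_eq_zero_iff two_ne_zero |>.1 hsq)
    have h₁₁ : α 1 1 = ε := by linear_combination htr' - h₀₀
    have h₀₁ : α 0 1 ≠ 0 := by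
      intro h₀₁
      refine hα (Matrix.SpecialLinearGroup.mem_center_iff.2
        ⟨ε, by rw [Fintype.card_fin, sq, hε], ?_⟩)
      ext i j
      fin_cases i <;> fin_cases j <;> simp [h₀₀, h₀₁, h₁₀, h₁₁]
    refine ⟨!![α 0 1, 0; 0, m], by simp [h₀₁, hm], ?_⟩
    ext i j
    fin_cases i <;> fin_cases j <;> simp [Matrix.mul_apply, h₀₀, h₁₀, h₁₁, mul_comm]
  · refine ⟨!![α 0 0 - ε, m; α 1 0, 0], by simp [h₁₀, hm], ?_⟩
    ext i j
    fin_cases i <;> fin_cases j <;> simp [Matrix.mul_apply]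
    · linear_combination hdet - α 0 0 * htr' - hε
    · ring
    · linear_combination -α 1 0 * htr'

end Entries

section Unipotent

open Matrix
open scoped commutatorElement

variable {R : Type*} [CommRing R] {X Y X' Y' : SL(2, R)}

lemma relations_of_commutator_eq_unipotent (h : ⁅X, Y⁆ = jordan 1 1 (one_mul 1)) :
    X 1 0 = 0 ∧ Y 1 0 = 0 ∧
      Y 0 1 * Y 0 0 * (X 0 0 ^ 2 - 1) + X 0 1 * X 0 0 * (1 - Y 0 0 ^ 2) = 1 := by
  have hX := det_entries X
  have hY := det_entries Y
  obtain ⟨h₁, h₂, h₃, h₄⟩ := commutator_eq_jordan_iff.1 h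
  have hcf : X 1 0 * Y 0 1 = Y 1 0 * X 0 1 := by linear_combination h₄
  have hg1 : Y 1 0 * X 0 0 + Y 1 1 * X 1 0 = 0 := by linear_combination -h₁ - hcf
  have hg2 : X 1 0 * Y 0 0 + X 1 1 * Y 1 0 = 0 := by linear_combination h₃ + hg1
  have hY₁₀ : Y 1 0 = 0 := by
    linear_combination X 1 0 * h₂ - (X 0 0 - X 1 1) * hcf + (X 1 1 - X 0 1) * hg1 +
      X 0 1 * hg2 - Y 1 0 * hX
  have hX₁₀ : X 1 0 = 0 := by
    linear_combination -X 1 0 * hY + Y 0 0 * hg1 - (X 1 0 * Y 0 1 + Y 0 0 * X 0 0) * hY₁₀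
  refine ⟨hX₁₀, hY₁₀, ?_⟩
  linear_combination X 0 0 * Y 0 0 * h₂ + (Y 0 1 * Y 0 0 + Y 0 0 * Y 1 1) * hX +
    (1 - X 0 0 * X 0 1) * hY + Y 0 0 * X 0 1 * (Y 0 1 + Y 1 1) * hX₁₀ +
    (Y 0 1 - Y 0 1 * X 0 0 * X 0 1 + Y 0 0 * X 0 0 * X 0 1) * hY₁₀

lemma eq_of_commutator_eq_unipotent (h : ⁅X, Y⁆ = jordan 1 1 (one_mul 1))
    (h' : ⁅X', Y'⁆ = jordan 1 1 (one_mul 1)) (hX₀₀ : X 0 0 = X' 0 0) (hY₀₀ : Y 0 0 = Y' 0 0)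
    (hY₀₁ : Y 0 1 = Y' 0 1) (hu : IsUnit (1 - Y' 0 0 ^ 2)) : X = X' ∧ Y = Y' := by
  obtain ⟨hX₁₀, hY₁₀, hp⟩ := relations_of_commutator_eq_unipotent h
  obtain ⟨hX₁₀', hY₁₀', hp'⟩ := relations_of_commutator_eq_unipotent h'
  have hX := det_entries X
  have hY := det_entries Y
  have hX' := det_entries X'
  have hY' := det_entries Y'
  rw [hX₁₀, mul_zero, sub_zero, hX₀₀] at hX
  rw [hX₁₀', mul_zero, sub_zero] at hX'
  rw [hY₁₀, mul_zero, sub_zero, hY₀₀] at hY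
  rw [hY₁₀', mul_zero, sub_zero] at hY'
  have isUnit_X₀₀ : IsUnit (X' 0 0) := IsUnit.of_mul_eq_one _ hX'
  have isUnit_Y₀₀ : IsUnit (Y' 0 0) := IsUnit.of_mul_eq_one _ hY'
  refine ⟨eq_of_entries hX₀₀ ?_ (hX₁₀.trans hX₁₀'.symm)
    (isUnit_X₀₀.mul_left_cancel (hX.trans hX'.symm)),
    eq_of_entries hY₀₀ hY₀₁ (hY₁₀.trans hY₁₀'.symm)
      (isUnit_Y₀₀.mul_left_cancel (hY.trans hY'.symm))⟩
  rw [hX₀₀, hY₀₀, hY₀₁] at hp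
  exact (isUnit_X₀₀.mul hu).mul_right_cancel (by linear_combination hp - hp')

lemma exists_commutator_eq_unipotent {x y : R} (q : R) (hx : IsUnit x) (hy : IsUnit y)
    (hu : IsUnit (1 - y ^ 2)) : ∃ X Y : SL(2, R),
      ⁅X, Y⁆ = jordan 1 1 (one_mul 1) ∧ X 0 0 = x ∧ Y 0 0 = y ∧ Y 0 1 = q := by
  obtain ⟨x', hx'⟩ := hx.exists_right_inv
  obtain ⟨y', hy'⟩ := hy.exists_right_inv
  obtain ⟨r, hr⟩ := hu.exists_right_inv
  let p := (1 - q * y * (x ^ 2 - 1)) * x' * r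
  refine ⟨⟨!![x, p; 0, x'], by simp [hx']⟩, ⟨!![y, q; 0, y'], by simp [hy']⟩,
    commutator_eq_jordan_iff.2 ?_, rfl, rfl, rfl⟩
  suffices x * q + p * y' = y * p + q * x' + y' * x' by simpa [mul_comm x, mul_comm x'] using this
  linear_combination ((1 - q * y * (x ^ 2 - 1)) * x' * r * y - q * (x ^ 2 - 1) * x') * hy' +
    (1 - q * y * (x ^ 2 - 1)) * x' * y' * hr - q * x * hx'

lemma span_pair_eq_top_of_commutator_eq_unipotent (h : ⁅X, Y⁆ = jordan 1 1 (one_mul 1)) :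
    Ideal.span {1 - Y 0 0 ^ 2, 1 - (Y * X) 0 0 ^ 2} = ⊤ := by
  obtain ⟨hX₁₀, hY₁₀, h⟩ := relations_of_commutator_eq_unipotent h
  have hY := det_entries Y
  rw [hY₁₀, mul_zero, sub_zero] at hY
  rw [mul_entry, hX₁₀, mul_zero, add_zero, Ideal.eq_top_iff_one, Ideal.mem_span_pair]
  refine ⟨Y 0 1 * Y 1 1 + X 0 1 * X 0 0, -(Y 0 1 * Y 1 1), ?_⟩
  linear_combination h + Y 0 1 * Y 0 0 * (X 0 0 ^ 2 - 1) * hY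

end Unipotent

section UnipotentVariety

open Matrix MvPolynomial
open scoped commutatorElement

variable {k : Type u} [Field k]

lemma aeval_ne_zero_of_eval_ne_zero {R σ : Type*} [CommRing R] [Algebra k R] {x : σ → R}
    (hx : AlgebraicIndependent k x) {p : MvPolynomial σ k} (v : σ → k) (hp : eval v p ≠ 0) :
    aeval x p ≠ 0 :=
  (map_ne_zero_iff _ hx).2 fun h => hp (by rw [h, map_zero])

/-- The coordinate ring of the commutator variety of the unipotent Jordan block. -/
abbrev CoordUnipotent (k : Type u) [Field k] : Type u := Coord (jordan (1 : k) 1 (one_mul 1))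

lemma map_jordan_one_one (R : Type*) [CommRing R] [Algebra k R] :
    SpecialLinearGroup.map (algebraMap k R) (jordan 1 1 (one_mul 1)) =
      jordan 1 1 (one_mul 1) := by
  rw [map_jordan]
  simp only [map_one]

lemma commutator_pointX_pointY_unipotent {R : Type*} [CommRing R] [Algebra k R]
    (φ : CoordUnipotent k →ₐ[k] R) : ⁅pointX φ, pointY φ⁆ = jordan 1 1 (one_mul 1) := by
  rw [commutator_pointX_pointY, map_jordan_one_one]

lemma isChart_unipotent :
    IsChart (k := k) (n := 3) (A := CoordUnipotent k) (1 - univY _ 0 0 ^ 2) 1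
      ![univX _ 0 0, univY _ 0 0, univY _ 0 1] (X 0 * X 1 * (1 - X 1 ^ 2)) where
  den_dvd := one_dvd _
  exists_point x hx := by
    simp only [map_mul, map_sub, map_pow, map_one, aeval_X, IsUnit.mul_iff] at hx
    obtain ⟨X, Y, hXY, hX₀₀, hY₀₀, hY₀₁⟩ :=
      exists_commutator_eq_unipotent (x 2) hx.1.1 hx.1.2 hx.2
    refine ⟨point X Y (hXY.trans (map_jordan_one_one _).symm), ?_, ?_⟩
    · simpa only [map_sub, map_one, map_pow, point_univY, hY₀₀] using hx.2
    · simp [Fin.forall_fin_succ, point_univX, point_univY, hX₀₀, hY₀₀, hY₀₁]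
  isUnit_aeval φ x hφ hx := by
    have relations := relations_of_commutator_eq_unipotent (commutator_pointX_pointY_unipotent φ)
    have hX := det_entries (pointX φ)
    have hY := det_entries (pointY φ)
    rw [relations.1, mul_zero, sub_zero] at hX
    rw [relations.2.1, mul_zero, sub_zero] at hY
    have hx₀ : pointX φ 0 0 = x 0 := (hx 0).trans (by rw [map_one, mul_one])
    have hx₁ : pointY φ 0 0 = x 1 := (hx 1).trans (by rw [map_one, mul_one])
    rw [map_sub, map_one, map_pow] at hφ
    simp only [map_mul, map_sub, map_pow, map_one, aeval_X, ← hx₀, ← hx₁]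
    exact ((IsUnit.of_mul_eq_one _ hX).mul (IsUnit.of_mul_eq_one _ hY)).mul hφ
  point_unique φ ψ x _ hψ hφx hψx := by
    simp only [map_sub, map_pow, map_one, mul_one, Fin.forall_fin_succ] at hψ hφx hψx
    obtain ⟨hX, hY⟩ := eq_of_commutator_eq_unipotent
      (commutator_pointX_pointY_unipotent φ) (commutator_pointX_pointY_unipotent ψ)
      (hφx.1.trans hψx.1.symm) (hφx.2.1.trans hψx.2.1.symm)
      (hφx.2.2.1.trans hψx.2.2.1.symm) hψ
    exact point_ext hX hY

lemma apply_twistRight_univY {α : SL(2, k)} {R : Type*} [CommRing R] [Algebra k R]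
    (φ : Coord α →ₐ[k] R) (i j : Fin 2) :
    φ (twistRight α (univY α i j)) = (pointY φ * pointX φ) i j :=
  congrArg (fun Y : SL(2, R) => Y i j) (pointY_comp_twistRight φ)

variable (k) in
lemma span_unipotent_eq_top :
    Ideal.span ((fun τ : CoordUnipotent k ≃ₐ[k] CoordUnipotent k => τ (1 - univY _ 0 0 ^ 2)) ''
      {AlgEquiv.refl, twistRight _}) = ⊤ := by
  have twist := apply_twistRight_univY (AlgHom.id k (CoordUnipotent k)) 0 0
  rw [pointX_id, pointY_id, AlgHom.id_apply] at twist
  rw [Set.image_pair]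
  simp only [map_sub, map_one, map_pow, twist, AlgEquiv.coe_refl, id_eq]
  exact span_pair_eq_top_of_commutator_eq_unipotent
    ((commutator_univX_univY _).trans (map_jordan_one_one _))

lemma isRationalDomain_unipotent : IsRationalDomain k (CoordUnipotent k) 3 := by
  refine isChart_unipotent.isRationalDomain ?_ (span_unipotent_eq_top k) ?_
  · exact mul_ne_zero (mul_ne_zero (X_ne_zero 0) (X_ne_zero 1))
      fun h => by simpa using congrArg (eval 0) h
  rintro D _ _ _ φ x independent hφ hx τ (rfl | rfl)
  · exact hφ.ne_zero
  · have hX₁₀ := (relations_of_commutator_eq_unipotent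
      (commutator_pointX_pointY_unipotent φ)).1
    have hx₀ : pointX φ 0 0 = x 0 := (hx 0).trans (by rw [map_one, mul_one])
    have hx₁ : pointY φ 0 0 = x 1 := (hx 1).trans (by rw [map_one, mul_one])
    have twist : φ (twistRight _ (univY _ 0 0)) = x 1 * x 0 := by
      rw [apply_twistRight_univY, mul_entry, hX₁₀, mul_zero, add_zero, hx₀, hx₁]
    have generic := aeval_ne_zero_of_eval_ne_zero (p := 1 - (X 1 * X 0) ^ 2) independent 0 (by simp)
    rw [map_sub, map_one, map_pow, map_mul, aeval_X, aeval_X] at generic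
    simpa only [map_sub, map_one, map_pow, twist] using generic

end UnipotentVariety

section NegativeJordan

open Matrix
open scoped commutatorElement

variable {R : Type*} [CommRing R] {X Y X' Y' : SL(2, R)}

/-- A Jordan block with eigenvalue `-1`, for which the entry `-2` off the diagonal makes the
equations of the commutator variety simplest. -/
abbrev negJordan (R : Type*) [CommRing R] : SL(2, R) :=
  jordan (-1) (-2) (by rw [neg_mul_neg, one_mul])

lemma trace_entries (X : SL(2, R)) : X.1.trace = X 0 0 + X 1 1 := trace_fin_two _

lemma trace_mul_mul_self (X Y : SL(2, R)) :
    (X * (Y * X)).1.trace = X.1.trace * (X * Y).1.trace - Y.1.trace := by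
  have hX := det_entries X
  simp only [trace_entries, mul_entry]
  linear_combination -(Y 0 0 + Y 1 1) * hX

lemma inv_entries (X : SL(2, R)) :
    X⁻¹ 0 0 = X 1 1 ∧ X⁻¹ 0 1 = -X 0 1 ∧ X⁻¹ 1 0 = -X 1 0 ∧ X⁻¹ 1 1 = X 0 0 := by
  simp [Matrix.SpecialLinearGroup.coe_inv, adjugate_fin_two]

lemma trace_mul_inv (X Y : SL(2, R)) :
    (Y * X⁻¹).1.trace = X.1.trace * Y.1.trace - (X * Y).1.trace := by
  simp only [trace_entries, mul_entry, inv_entries]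
  ring

lemma trace_commutator (X Y : SL(2, R)) : ⁅X, Y⁆.1.trace =
    X.1.trace ^ 2 + Y.1.trace ^ 2 + (X * Y).1.trace ^ 2 -
      X.1.trace * Y.1.trace * (X * Y).1.trace - 2 := by
  have hX := det_entries X
  have hY := det_entries Y
  simp only [commutatorElement_def, trace_entries, mul_entry, inv_entries]
  grind

lemma relations_of_commutator_eq_negJordan (h2 : IsUnit (2 : R))
    (hXY : ⁅X, Y⁆ = negJordan R) :
    X 1 0 = X.1.trace ∧ Y 1 0 = -Y.1.trace ∧
      X.1.trace * Y 1 1 = Y.1.trace * X 0 0 - (X * Y).1.trace ∧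
      X.1.trace * Y 0 1 = Y.1.trace * X 0 1 - 2 * X 1 1 * Y 1 1 := by
  have hX := det_entries X
  have hY := det_entries Y
  obtain ⟨h₁, h₂, h₃, h₄⟩ := commutator_eq_jordan_iff.1 hXY
  simp only [trace_entries, mul_entry]
  have two_mul_X₁₀ : 2 * X 1 0 = 2 * (X 0 0 + X 1 1) := by
    linear_combination Y 1 1 * (2 * h₃ - h₁) + Y 1 0 * (h₂ - 2 * h₄) + Y 0 1 * h₃ -
      Y 0 0 * h₄ + 2 * (X 0 0 + X 1 1 - X 1 0) * hY
  have two_mul_Y₁₀ : 2 * Y 1 0 = 2 * -(Y 0 0 + Y 1 1) := by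
    linear_combination X 1 1 * h₁ - X 1 0 * h₂ - X 0 1 * h₃ + X 0 0 * h₄ -
      (2 * (Y 0 0 + Y 1 1) + 2 * Y 1 0) * hX
  have hX₁₀ := h2.mul_left_cancel two_mul_X₁₀
  have hY₁₀ := h2.mul_left_cancel two_mul_Y₁₀
  exact ⟨hX₁₀, hY₁₀, by linear_combination h₄,
    by linear_combination h₄ - Y 0 1 * hX₁₀ - X 0 1 * hY₁₀⟩

lemma isCoprime_trace_of_commutator_eq_negJordan (h2 : IsUnit (2 : R))
    (hXY : ⁅X, Y⁆ = negJordan R) : IsCoprime X.1.trace Y.1.trace := by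
  obtain ⟨hX₁₀, hY₁₀, hY₁₁, hY₀₁⟩ := relations_of_commutator_eq_negJordan h2 hXY
  have hX := det_entries X
  have hY := det_entries Y
  obtain ⟨j, hj⟩ := h2.exists_right_inv
  simp only [trace_entries, mul_entry] at *
  refine ⟨j * (-X 0 0 * Y 0 0 * Y 0 1 - 2 * X 0 1 + 2 * (Y 0 0 + Y 1 1) * X 0 1 * Y 0 1),
    j * (X 0 0 * Y 0 0 * X 0 1 + 2 * Y 0 1), ?_⟩
  grind

lemma exists_commutator_eq_negJordan {p q t : R} (r : R)
    (ht : IsUnit t) (hpq : 1 + p ^ 2 + q ^ 2 = p * q * t) :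
    ∃ X Y : SL(2, R), ⁅X, Y⁆ = negJordan R ∧ X.1.trace = t ∧ Y.1.trace = p * t ∧
      (X * Y).1.trace = q * t ∧ X 0 0 = r * t := by
  obtain ⟨t', ht'⟩ := ht.exists_right_inv
  let b := r * (1 - r) * t - t'
  let d := p * r * t - q
  have hX : (!![r * t, b; t, (1 - r) * t] : Matrix _ _ R).det = 1 := by
    rw [det_fin_two_of]
    linear_combination ht'
  have hY : (!![p * t - d, p * b - 2 * (1 - r) * d; -p * t, d] : Matrix _ _ R).det = 1 := by
    rw [det_fin_two_of]
    grind
  let X : SL(2, R) := ⟨_, hX⟩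
  let Y : SL(2, R) := ⟨_, hY⟩
  have htX : X.1.trace = t := (trace_fin_two_of _ _ _ _).trans (by ring)
  have htY : Y.1.trace = p * t := (trace_fin_two_of _ _ _ _).trans (by ring)
  refine ⟨X, Y, commutator_eq_jordan_iff.2 ?_, htX, htY, ?_, rfl⟩
  · simp only [X, Y, of_apply, cons_val_zero, cons_val_one, cons_val', cons_val_fin_one]
    grind
  · rw [trace_entries, mul_entry, mul_entry]
    simp only [X, Y, of_apply, cons_val_zero, cons_val_one, cons_val', cons_val_fin_one]
    grind

lemma markov_of_commutator_eq_negJordan (hXY : ⁅X, Y⁆ = negJordan R) :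
    X.1.trace ^ 2 + Y.1.trace ^ 2 + (X * Y).1.trace ^ 2 =
      X.1.trace * Y.1.trace * (X * Y).1.trace := by
  have htr := trace_commutator X Y
  rw [hXY, negJordan, jordan, trace_fin_two_of] at htr
  linear_combination -htr

lemma eq_of_commutator_eq_negJordan (h2 : IsUnit (2 : R))
    (hXY : ⁅X, Y⁆ = negJordan R) (hXY' : ⁅X', Y'⁆ = negJordan R)
    (ht : X.1.trace = X'.1.trace) (hs : Y.1.trace = Y'.1.trace)
    (hw : (X * Y).1.trace = (X' * Y').1.trace) (h₀₀ : X 0 0 = X' 0 0)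
    (hu : IsUnit X'.1.trace) : X = X' ∧ Y = Y' := by
  obtain ⟨hX₁₀, hY₁₀, hY₁₁, hY₀₁⟩ := relations_of_commutator_eq_negJordan h2 hXY
  obtain ⟨hX₁₀', hY₁₀', hY₁₁', hY₀₁'⟩ := relations_of_commutator_eq_negJordan h2 hXY'
  have hX := det_entries X
  have hX' := det_entries X'
  rw [hX₁₀, ht] at hX
  rw [hX₁₀'] at hX'
  rw [ht, hs, hw, h₀₀] at hY₁₁
  rw [ht, hs] at hY₀₁
  have eqX₁₁ : X 1 1 = X' 1 1 := by linear_combination ht - trace_entries X + trace_entries X' - h₀₀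
  have eqX₀₁ : X 0 1 = X' 0 1 := hu.mul_right_cancel <| by
    linear_combination hX' - hX + X 1 1 * h₀₀ + X' 0 0 * eqX₁₁
  have eqY₁₁ : Y 1 1 = Y' 1 1 := hu.mul_left_cancel (hY₁₁.trans hY₁₁'.symm)
  have eqY₀₁ : Y 0 1 = Y' 0 1 := hu.mul_left_cancel <| by rw [hY₀₁, hY₀₁', eqX₀₁, eqX₁₁, eqY₁₁]
  have eqY₀₀ : Y 0 0 = Y' 0 0 := by
    linear_combination hs - trace_entries Y + trace_entries Y' - eqY₁₁
  exact ⟨eq_of_entries h₀₀ eqX₀₁ (by rw [hX₁₀, hX₁₀', ht]) eqX₁₁,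
    eq_of_entries eqY₀₀ eqY₀₁ (by rw [hY₁₀, hY₁₀', hs]) eqY₁₁⟩

/-- The product of the traces of `X`, `Y` and `X Y`, three functions on pairs of matrices which
satisfy Markov's equation when the commutator of `X` and `Y` has trace `-2`. -/
def traceProd (X Y : SL(2, R)) : R := X.1.trace * Y.1.trace * (X * Y).1.trace

lemma markov_of_isUnit_traceProd (hXY : ⁅X, Y⁆ = negJordan R) (hu : IsUnit (traceProd X Y))
    {p q : R} (hp : Y.1.trace = p * X.1.trace) (hq : (X * Y).1.trace = q * X.1.trace) :
    IsUnit X.1.trace ∧ IsUnit p ∧ IsUnit q ∧ 1 + p ^ 2 + q ^ 2 = p * q * X.1.trace := by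
  have markov := markov_of_commutator_eq_negJordan hXY
  simp only [traceProd, hp, hq, IsUnit.mul_iff] at hu markov
  obtain ⟨⟨ht, hp, -⟩, hq, -⟩ := hu
  refine ⟨ht, hp, hq, (ht.pow 2).mul_left_cancel ?_⟩
  linear_combination markov

lemma traceProd_mul_right (X Y : SL(2, R)) : traceProd X (Y * X) =
    X.1.trace * (X * Y).1.trace * (X.1.trace * (X * Y).1.trace - Y.1.trace) := by
  rw [traceProd, trace_mul_mul_self]
  congr 2
  exact trace_mul_comm _ _

lemma traceProd_mul_inv_right (X Y : SL(2, R)) : traceProd X (Y * X⁻¹) =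
    X.1.trace * Y.1.trace * (X.1.trace * Y.1.trace - (X * Y).1.trace) := by
  rw [traceProd, trace_mul_inv]
  have : (X * (Y * X⁻¹)).1.trace = Y.1.trace :=
    (trace_mul_comm _ _).trans (congrArg (fun Z : SL(2, R) => Z.1.trace) (inv_mul_cancel_right Y X))
  rw [this]
  ring

lemma traceProd_mul_left (X Y : SL(2, R)) : traceProd (X * Y) Y =
    Y.1.trace * (X * Y).1.trace * (Y.1.trace * (X * Y).1.trace - X.1.trace) := by
  have hY := det_entries Y
  have trace_mul_self : (X * Y * Y).1.trace = Y.1.trace * (X * Y).1.trace - X.1.trace := by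
    simp only [trace_entries, mul_entry]
    linear_combination -(X 0 0 + X 1 1) * hY
  rw [traceProd, trace_mul_self]
  ring

lemma traceProd_ne_zero [IsDomain R] (hXY : ⁅X, Y⁆ = negJordan R)
    (hu : IsUnit (traceProd X Y)) {p q : R} (hp : Y.1.trace = p * X.1.trace)
    (hq : (X * Y).1.trace = q * X.1.trace) (hpp : 1 + p ^ 2 ≠ 0) (hqq : 1 + q ^ 2 ≠ 0)
    (hpq : p ^ 2 + q ^ 2 ≠ 0) :
    ∀ z ∈ ({traceProd X Y, traceProd X (Y * X), traceProd X (Y * X⁻¹),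
      traceProd (X * Y) Y} : Set R), z ≠ 0 := by
  obtain ⟨ht, -, -, h⟩ := markov_of_isUnit_traceProd hXY hu hp hq
  obtain ⟨⟨-, hs⟩, hw⟩ := by simpa only [traceProd, IsUnit.mul_iff] using hu
  rintro z (rfl | rfl | rfl | rfl) hz
  · exact hu.ne_zero hz
  · rw [traceProd_mul_right, (ht.mul hw).mul_right_eq_zero, hp, hq] at hz
    have : q * X.1.trace - p = 0 := ht.mul_right_eq_zero.1 (by linear_combination hz)
    exact hqq (by linear_combination h + p * this)
  · rw [traceProd_mul_inv_right, (ht.mul hs).mul_right_eq_zero, hp, hq] at hz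
    have : p * X.1.trace - q = 0 := ht.mul_right_eq_zero.1 (by linear_combination hz)
    exact hpp (by linear_combination h + q * this)
  · rw [traceProd_mul_left, (hs.mul hw).mul_right_eq_zero, hp, hq] at hz
    have : p * q * X.1.trace - 1 = 0 := ht.mul_right_eq_zero.1 (by linear_combination hz)
    exact hpq (by linear_combination h + this)

lemma span_traceProd_eq_top (h2 : IsUnit (2 : R)) (hXY : ⁅X, Y⁆ = negJordan R) :
    Ideal.span {traceProd X Y, traceProd X (Y * X), traceProd X (Y * X⁻¹),
      traceProd (X * Y) Y} = ⊤ := by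
  have coprime := isCoprime_trace_of_commutator_eq_negJordan h2 hXY
  have markov := markov_of_commutator_eq_negJordan hXY
  obtain ⟨A, B, hAB⟩ := coprime.pow (m := 4) (n := 4)
  rw [traceProd_mul_right, traceProd_mul_inv_right, traceProd_mul_left, traceProd,
    Ideal.eq_top_iff_one]
  simp only [Ideal.mem_span_insert', Ideal.mem_span_singleton']
  set t := X.1.trace
  set s := Y.1.trace
  set w := (X * Y).1.trace
  refine ⟨-(A * (t ^ 2 - 2) + B * (s ^ 2 - 2)), A, A + B, -B, ?_⟩
  linear_combination hAB - (A * t ^ 2 + B * s ^ 2) * markov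

end NegativeJordan

section NegativeJordanVariety

open Matrix MvPolynomial
open scoped commutatorElement

variable {k : Type u} [Field k] {R : Type*} [CommRing R] [Algebra k R]

lemma map_negJordan : SpecialLinearGroup.map (algebraMap k R) (negJordan k) = negJordan R := by
  rw [negJordan, map_jordan]
  simp only [map_neg, map_one, map_ofNat]

lemma commutator_pointX_pointY_negJordan (φ : Coord (negJordan k) →ₐ[k] R) :
    ⁅pointX φ, pointY φ⁆ = negJordan R := by
  rw [commutator_pointX_pointY, map_negJordan]

variable (k) in
lemma commutator_univX_univY_negJordan :
    ⁅univX (negJordan k), univY (negJordan k)⁆ = negJordan (Coord (negJordan k)) :=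
  commutator_pointX_pointY_negJordan (AlgHom.id k _)

lemma apply_trace {A : Type*} [CommRing A] [Algebra k A] (φ : A →ₐ[k] R) (X : SL(2, A)) :
    φ X.1.trace = (SpecialLinearGroup.map (φ : A →+* R) X).1.trace :=
  AddMonoidHom.map_trace φ X.1

section

variable {α : SL(2, k)} (φ : Coord α →ₐ[k] R)

lemma apply_trace_univX : φ (univX α).1.trace = (pointX φ).1.trace := apply_trace φ _

lemma apply_trace_univY : φ (univY α).1.trace = (pointY φ).1.trace := apply_trace φ _

lemma apply_trace_univX_mul_univY :
    φ (univX α * univY α).1.trace = (pointX φ * pointY φ).1.trace := by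
  rw [apply_trace, map_mul]
  rfl

lemma apply_traceProd_univX_univY :
    φ (traceProd (univX α) (univY α)) = traceProd (pointX φ) (pointY φ) := by
  rw [traceProd, map_mul, map_mul, apply_trace_univX, apply_trace_univY,
    apply_trace_univX_mul_univY, traceProd]

lemma apply_twistRight_traceProd : φ (twistRight α (traceProd (univX α) (univY α))) =
    traceProd (pointX φ) (pointY φ * pointX φ) := by
  have := apply_traceProd_univX_univY (φ.comp (twistRight α : Coord α →ₐ[k] Coord α))
  rwa [pointX_comp_twistRight, pointY_comp_twistRight] at this

lemma apply_twistRight_symm_traceProd : φ ((twistRight α).symm (traceProd (univX α) (univY α))) =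
    traceProd (pointX φ) (pointY φ * (pointX φ)⁻¹) := by
  have := apply_traceProd_univX_univY (φ.comp ((twistRight α).symm : Coord α →ₐ[k] Coord α))
  rwa [pointX_comp_twistRight_symm, pointY_comp_twistRight_symm] at this

lemma apply_twistLeft_traceProd : φ (twistLeft α (traceProd (univX α) (univY α))) =
    traceProd (pointX φ * pointY φ) (pointY φ) := by
  have := apply_traceProd_univX_univY (φ.comp (twistLeft α : Coord α →ₐ[k] Coord α))
  rwa [pointX_comp_twistLeft, pointY_comp_twistLeft] at this

end

lemma trace_of_chart {φ : Coord (negJordan k) →ₐ[k] R} {x : Fin 3 → R}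
    (hx : ∀ i, φ (![(univY _).1.trace, (univX _ * univY _).1.trace, univX _ 0 0] i) =
      x i * φ (univX _).1.trace) :
    (pointY φ).1.trace = x 0 * (pointX φ).1.trace ∧
      (pointX φ * pointY φ).1.trace = x 1 * (pointX φ).1.trace := by
  rw [← apply_trace_univX, ← apply_trace_univY, ← apply_trace_univX_mul_univY, ← hx 0, ← hx 1]
  exact ⟨rfl, rfl⟩

lemma markov_of_chart {φ : Coord (negJordan k) →ₐ[k] R} {x : Fin 3 → R}
    (hφ : IsUnit (φ (traceProd (univX _) (univY _))))
    (hx : ∀ i, φ (![(univY _).1.trace, (univX _ * univY _).1.trace, univX _ 0 0] i) =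
      x i * φ (univX _).1.trace) :
    IsUnit (pointX φ).1.trace ∧ IsUnit (x 0) ∧ IsUnit (x 1) ∧
      1 + x 0 ^ 2 + x 1 ^ 2 = x 0 * x 1 * (pointX φ).1.trace := by
  rw [apply_traceProd_univX_univY] at hφ
  exact markov_of_isUnit_traceProd (commutator_pointX_pointY_negJordan φ) hφ
    (trace_of_chart hx).1 (trace_of_chart hx).2

lemma isChart_negJordan (h2 : (2 : k) ≠ 0) :
    IsChart (k := k) (n := 3) (A := Coord (negJordan k)) (traceProd (univX _) (univY _))
      (univX _).1.trace ![(univY _).1.trace, (univX _ * univY _).1.trace, univX _ 0 0]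
      (X 0 * X 1 * (1 + X 0 ^ 2 + X 1 ^ 2)) where
  den_dvd := ⟨_, mul_assoc _ _ _⟩
  exists_point x hx := by
    simp only [map_mul, map_add, map_pow, map_one, aeval_X, IsUnit.mul_iff] at hx
    obtain ⟨⟨hp, hq⟩, hr⟩ := hx
    obtain ⟨v, hv⟩ := (hp.mul hq).exists_right_inv
    have ht : IsUnit ((1 + x 0 ^ 2 + x 1 ^ 2) * v) := hr.mul (.of_mul_eq_one_right _ hv)
    obtain ⟨X, Y, hXY, htX, htY, htXY, hX₀₀⟩ := exists_commutator_eq_negJordan (x 2) ht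
      (p := x 0) (q := x 1) (by linear_combination -(1 + x 0 ^ 2 + x 1 ^ 2) * hv)
    refine ⟨point X Y (hXY.trans map_negJordan.symm), ?_, ?_⟩
    · rw [apply_traceProd_univX_univY, pointX_point, pointY_point, traceProd, htX, htY, htXY]
      exact (ht.mul (hp.mul ht)).mul (hq.mul ht)
    · rw [apply_trace_univX, pointX_point, htX]
      refine Fin.forall_fin_succ.2 ⟨?_, Fin.forall_fin_two.2 ⟨?_, ?_⟩⟩
      · exact (apply_trace_univY _).trans (by rw [pointY_point, htY])
      · exact (apply_trace_univX_mul_univY _).trans (by rw [pointX_point, pointY_point, htXY]; rfl)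
      · exact (point_univX _ _ _ 0 0).trans hX₀₀
  isUnit_aeval φ x hφ hx := by
    obtain ⟨ht, hp, hq, h⟩ := markov_of_chart hφ hx
    simp only [map_mul, map_add, map_pow, map_one, aeval_X, h]
    exact (hp.mul hq).mul ((hp.mul hq).mul ht)
  point_unique φ ψ x hφ hψ hφx hψx := by
    obtain ⟨ht, hp, hq, h⟩ := markov_of_chart hφ hφx
    obtain ⟨-, -, -, h'⟩ := markov_of_chart hψ hψx
    have traceX := (hp.mul hq).mul_left_cancel (h.symm.trans h')
    have agree i : φ (![(univY _).1.trace, (univX _ * univY _).1.trace, univX _ 0 0] i) =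
        ψ (![(univY _).1.trace, (univX _ * univY _).1.trace, univX _ 0 0] i) := by
      rw [hφx, hψx, apply_trace_univX, apply_trace_univX, traceX]
    obtain ⟨hX, hY⟩ := eq_of_commutator_eq_negJordan (isUnit_two h2)
      (commutator_pointX_pointY_negJordan φ) (commutator_pointX_pointY_negJordan ψ) traceX
      ((apply_trace_univY φ).symm.trans ((agree 0).trans (apply_trace_univY ψ)))
      ((apply_trace_univX_mul_univY φ).symm.trans
        ((agree 1).trans (apply_trace_univX_mul_univY ψ)))
      (agree 2) (traceX ▸ ht)
    exact point_ext hX hY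

lemma image_twist_traceProd {α : SL(2, k)} (φ : Coord α →ₐ[k] R) :
    (fun τ : Coord α ≃ₐ[k] Coord α => φ (τ (traceProd (univX α) (univY α)))) ''
      {AlgEquiv.refl, twistRight α, (twistRight α).symm, twistLeft α} =
    {traceProd (pointX φ) (pointY φ), traceProd (pointX φ) (pointY φ * pointX φ),
      traceProd (pointX φ) (pointY φ * (pointX φ)⁻¹),
      traceProd (pointX φ * pointY φ) (pointY φ)} := by
  simp only [Set.image_insert_eq, Set.image_singleton, apply_twistRight_traceProd,
    apply_twistRight_symm_traceProd, apply_twistLeft_traceProd, AlgEquiv.coe_refl, id_eq,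
    apply_traceProd_univX_univY]

lemma isRationalDomain_negJordan (h2 : (2 : k) ≠ 0) :
    IsRationalDomain k (Coord (negJordan k)) 3 := by
  refine (isChart_negJordan h2).isRationalDomain
    (T := {AlgEquiv.refl, twistRight _, (twistRight _).symm, twistLeft _}) ?_ ?_ ?_
  · exact mul_ne_zero (mul_ne_zero (X_ne_zero 0) (X_ne_zero 1))
      fun h => by simpa using congrArg (eval 0) h
  · exact (congrArg Ideal.span (image_twist_traceProd (AlgHom.id k (Coord (negJordan k))))).trans
      (span_traceProd_eq_top (isUnit_two h2) (commutator_univX_univY_negJordan k))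
  · intro D _ _ _ φ x independent hφ hx τ hτ
    obtain ⟨hp, hq⟩ := trace_of_chart hx
    rw [apply_traceProd_univX_univY] at hφ
    have hpp := aeval_ne_zero_of_eval_ne_zero (p := 1 + X 0 ^ 2) independent 0 (by simp)
    have hqq := aeval_ne_zero_of_eval_ne_zero (p := 1 + X 1 ^ 2) independent 0 (by simp)
    have hpq := aeval_ne_zero_of_eval_ne_zero (p := X 0 ^ 2 + X 1 ^ 2) independent
      ![1, 0, 0] (by simp)
    rw [map_add, map_one, map_pow, aeval_X] at hpp hqq
    rw [map_add, map_pow, map_pow, aeval_X, aeval_X] at hpq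
    exact traceProd_ne_zero (commutator_pointX_pointY_negJordan φ) hφ hp hq hpp hqq hpq _
      ((image_twist_traceProd φ).subset (Set.mem_image_of_mem _ hτ))

end NegativeJordanVariety

section QuaternionPair

variable {A : Type*} [Ring A] {x y x₀ y₀ : A}

/-- The images of `i` and `j` under a homomorphism from Hamilton's quaternions. -/
structure IsQuaternionPair (x y : A) : Prop where
  sq_left : x * x = -1
  sq_right : y * y = -1
  anticomm : x * y = -(y * x)

/-- The average of the conjugates of `m` under the quaternion group, which acts on the left through
`x`, `y` and on the right through `x₀`, `y₀`; up to a factor it is the projection of `m` to the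
space of intertwiners. -/
def average (x y x₀ y₀ m : A) : A := m - x * m * x₀ - y * m * y₀ - x * y * m * (x₀ * y₀)

lemma IsQuaternionPair.mul_average_left (h : IsQuaternionPair x y) (h₀ : IsQuaternionPair x₀ y₀)
    (m : A) : x * average x y x₀ y₀ m = average x y x₀ y₀ m * x₀ := by
  have hx (z : A) : x * (x * z) = -z := by rw [← mul_assoc, h.sq_left, neg_one_mul]
  have hyx₀ : y₀ * x₀ = -(x₀ * y₀) := by rw [h₀.anticomm, neg_neg]
  have hx₀ : x₀ * (x₀ * y₀) = -y₀ := by rw [← mul_assoc, h₀.sq_left, neg_one_mul]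
  simp only [average, mul_sub, sub_mul, mul_assoc, hx, hyx₀, mul_neg, hx₀, h₀.sq_left]
  noncomm_ring

lemma IsQuaternionPair.mul_average_right (h : IsQuaternionPair x y) (h₀ : IsQuaternionPair x₀ y₀)
    (m : A) : y * average x y x₀ y₀ m = average x y x₀ y₀ m * y₀ := by
  have hyx (z : A) : y * (x * z) = -(x * (y * z)) := by
    rw [← mul_assoc, ← mul_assoc, h.anticomm, neg_mul, neg_neg]
  have hy (z : A) : y * (y * z) = -z := by rw [← mul_assoc, h.sq_right, neg_one_mul]
  simp only [average, mul_sub, sub_mul, mul_assoc, hyx, hy, mul_neg, h₀.sq_right]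
  noncomm_ring

lemma average_conj (q : Aˣ) (x₀ y₀ m : A) :
    average (q * x₀ * ↑q⁻¹) (q * y₀ * ↑q⁻¹) x₀ y₀ m = q * average x₀ y₀ x₀ y₀ (↑q⁻¹ * m) := by
  simp only [average, mul_sub, mul_assoc, Units.mul_inv_cancel_left, Units.inv_mul_cancel_left]

end QuaternionPair

section Quaternion

open Matrix
open scoped commutatorElement

variable {R : Type*} [CommRing R] {X Y X' Y' : SL(2, R)} {u v : R}

lemma commutator_eq_neg_one_iff : ⁅X, Y⁆ = -1 ↔ X * Y = -(Y * X) := by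
  rw [commutator_eq_iff, neg_one_mul]

lemma trace_eq_zero_of_conj_eq_neg (h2 : IsUnit (2 : R)) (h : X * Y = -(Y * X)) :
    X.1.trace = 0 := by
  have htr : X.1.trace = -X.1.trace := by
    rw [← trace_neg]
    calc X.1.trace = (X * Y * Y⁻¹).1.trace := by rw [mul_inv_cancel_right]
      _ = (-(Y * X) * Y⁻¹).1.trace := by rw [h]
      _ = (Y⁻¹ * -(Y * X)).1.trace := trace_mul_comm _ _
      _ = (-X).1.trace := by rw [mul_neg, inv_mul_cancel_left]
  exact h2.mul_right_eq_zero.1 (by linear_combination htr)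

lemma sq_eq_neg_one_of_trace_eq_zero (h : X.1.trace = 0) : X.1 * X.1 = -1 := by
  have hX := det_entries X
  rw [trace_entries] at h
  ext i j
  fin_cases i <;> fin_cases j <;> simp [Matrix.mul_apply] <;> grind

lemma isQuaternionPair_of_commutator_eq_neg_one (h2 : IsUnit (2 : R)) (h : ⁅X, Y⁆ = -1) :
    IsQuaternionPair X.1 Y.1 := by
  rw [commutator_eq_neg_one_iff] at h
  have h' : Y * X = -(X * Y) := by rw [h, neg_neg]
  exact ⟨sq_eq_neg_one_of_trace_eq_zero (trace_eq_zero_of_conj_eq_neg h2 h),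
    sq_eq_neg_one_of_trace_eq_zero (trace_eq_zero_of_conj_eq_neg h2 h'), congrArg (·.1) h⟩

lemma conjGL_neg_one (P : GL (Fin 2) R) : conjGL P (-1) = -1 := by
  rw [conjGL_eq_iff]
  simp

/-- The standard matrix of square `-1` anticommuting with `quatJ`, where `u ^ 2 + v ^ 2 = -1`. -/
def quatI (u v : R) (h : -1 = u ^ 2 + v ^ 2) : SL(2, R) :=
  ⟨!![u, v; v, -u], by rw [det_fin_two_of]; linear_combination h⟩

/-- The rotation by a right angle. -/
def quatJ (R : Type*) [CommRing R] : SL(2, R) :=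
  ⟨!![0, 1; -1, 0], by rw [det_fin_two_of]; ring⟩

lemma commutator_quatI_quatJ (h : -1 = u ^ 2 + v ^ 2) : ⁅quatI u v h, quatJ R⁆ = -1 := by
  rw [commutator_eq_neg_one_iff]
  have : !![u, v; v, -u] * !![0, 1; -1, 0] = -(!![0, 1; -1, 0] * !![u, v; v, -u]) := by simp
  exact Subtype.ext this

lemma average_quatI_quatJ (h : -1 = u ^ 2 + v ^ 2) (M : Matrix (Fin 2) (Fin 2) R) :
    average (quatI u v h).1 (quatJ R).1 (quatI u v h).1 (quatJ R).1 M =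
      (2 * M.trace) • (1 : Matrix (Fin 2) (Fin 2) R) := by
  rw [M.eta_fin_two]
  ext i j
  fin_cases i <;> fin_cases j <;>
    simp [average, quatI, quatJ, trace_fin_two] <;> grind

/-- The average of a matrix unit, which intertwines the standard pair `(quatI u v, quatJ)` with
`(X, Y)` if these anticommute and have trace zero. -/
def intertwiner (u v : R) (X Y : SL(2, R)) : Matrix (Fin 2) (Fin 2) R :=
  average X.1 Y.1 !![u, v; v, -u] !![0, 1; -1, 0] (single 1 1 1)

lemma intertwiner_eq (u v : R) (X Y : SL(2, R)) : intertwiner u v X Y =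
    !![-v * X 0 1 + Y 0 1 - u * (X * Y) 0 1, u * X 0 1 - v * (X * Y) 0 1;
      -v * X 1 1 + Y 1 1 - u * (X * Y) 1 1, 1 + u * X 1 1 - v * (X * Y) 1 1] := by
  ext i j
  fin_cases i <;> fin_cases j <;>
    simp [intertwiner, average, mul_entry, Matrix.mul_apply, single] <;> ring

lemma mul_intertwiner (h2 : IsUnit (2 : R)) (h : -1 = u ^ 2 + v ^ 2) (hXY : ⁅X, Y⁆ = -1) :
    X.1 * intertwiner u v X Y = intertwiner u v X Y * (quatI u v h).1 ∧
      Y.1 * intertwiner u v X Y = intertwiner u v X Y * (quatJ R).1 := by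
  have pair := isQuaternionPair_of_commutator_eq_neg_one h2 hXY
  have pair₀ := isQuaternionPair_of_commutator_eq_neg_one h2 (commutator_quatI_quatJ h)
  exact ⟨pair.mul_average_left pair₀ _, pair.mul_average_right pair₀ _⟩

lemma intertwiner_conjGL (h : -1 = u ^ 2 + v ^ 2) (Q : GL (Fin 2) R) :
    intertwiner u v (conjGL Q (quatI u v h)) (conjGL Q (quatJ R)) = (2 * Q⁻¹.1 1 1) • Q.1 := by
  have := average_conj Q (quatI u v h).1 (quatJ R).1 (single 1 1 1)
  rw [average_quatI_quatJ, mul_smul_comm, mul_one] at this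
  refine this.trans ?_
  congr 2
  simp [trace_fin_two, Matrix.mul_apply, single]

lemma entries_of_commutator_eq_neg_one (h2 : IsUnit (2 : R)) (hXY : ⁅X, Y⁆ = -1) :
    X 1 1 = -X 0 0 ∧ Y 1 1 = -Y 0 0 ∧ 2 * X 0 0 * Y 0 0 + X 0 1 * Y 1 0 + X 1 0 * Y 0 1 = 0 := by
  rw [commutator_eq_neg_one_iff] at hXY
  have hX := trace_eq_zero_of_conj_eq_neg h2 hXY
  have hY := trace_eq_zero_of_conj_eq_neg (Y := X) h2 (by rw [hXY, neg_neg])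
  have entry : (X * Y) 0 0 = -(Y * X) 0 0 := by rw [hXY]; rfl
  rw [trace_entries] at hX hY
  rw [mul_entry, mul_entry] at entry
  exact ⟨by linear_combination hX, by linear_combination hY, by linear_combination entry⟩

lemma det_intertwiner (h2 : IsUnit (2 : R)) (h : -1 = u ^ 2 + v ^ 2) (hXY : ⁅X, Y⁆ = -1) :
    (intertwiner u v X Y).det = 2 * intertwiner u v X Y 0 0 := by
  obtain ⟨hX₁₁, hY₁₁, hXY⟩ := entries_of_commutator_eq_neg_one h2 hXY
  have hX := det_entries X
  have hY := det_entries Y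
  rw [intertwiner_eq, det_fin_two_of]
  simp only [mul_entry, of_apply, cons_val', cons_val_zero, cons_val_fin_one]
  grind

lemma intertwiner_dvd_sq (h2 : IsUnit (2 : R)) (h : -1 = u ^ 2 + v ^ 2) (hXY : ⁅X, Y⁆ = -1) :
    intertwiner u v X Y 0 0 ∣ intertwiner u v X Y 1 1 ^ 2 := by
  obtain ⟨hX₁₁, hY₁₁, hXY⟩ := entries_of_commutator_eq_neg_one h2 hXY
  have hX := det_entries X
  have hY := det_entries Y
  refine ⟨-v * X 1 0 - Y 1 0 - u * (X * Y) 1 0, ?_⟩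
  simp only [intertwiner_eq, mul_entry, of_apply, cons_val', cons_val_zero, cons_val_one,
    cons_val_fin_one]
  grind

lemma conjGL_quatJ_entries (X : SL(2, R)) :
    conjGL (quatJ R : GL (Fin 2) R) X 0 0 = X 1 1 ∧ conjGL (quatJ R) X 0 1 = -X 1 0 ∧
      conjGL (quatJ R) X 1 1 = X 0 0 := by
  change (quatJ R * X * (quatJ R)⁻¹) 0 0 = _ ∧ (quatJ R * X * (quatJ R)⁻¹) 0 1 = _ ∧
    (quatJ R * X * (quatJ R)⁻¹) 1 1 = _
  simp only [mul_entry, inv_entries]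
  simp [quatJ]

lemma intertwiner_one_zero_sq (h2 : IsUnit (2 : R)) (h : -1 = u ^ 2 + v ^ 2)
    (hXY : ⁅X, Y⁆ = -1) : intertwiner u v X Y 1 0 ^ 2 = intertwiner u v X Y 0 0 *
      intertwiner u v (conjGL (quatJ R) X) (conjGL (quatJ R) Y) 0 0 := by
  obtain ⟨hX₁₁, hY₁₁, hXY⟩ := entries_of_commutator_eq_neg_one h2 hXY
  have hX := det_entries X
  have hY := det_entries Y
  simp only [intertwiner_eq, ← map_mul, conjGL_quatJ_entries]
  simp only [mul_entry, of_apply, cons_val', cons_val_zero, cons_val_one, cons_val_fin_one]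
  grind

lemma intertwiner_one_one_add (h2 : IsUnit (2 : R)) (hXY : ⁅X, Y⁆ = -1) :
    intertwiner u v X Y 1 1 +
      intertwiner u v (conjGL (quatJ R) X) (conjGL (quatJ R) Y) 1 1 = 2 := by
  obtain ⟨hX₁₁, hY₁₁, hXY⟩ := entries_of_commutator_eq_neg_one h2 hXY
  simp only [intertwiner_eq, ← map_mul, conjGL_quatJ_entries]
  simp only [mul_entry, of_apply, cons_val', cons_val_one, cons_val_fin_one]
  grind

lemma span_intertwiner_eq_top (h2 : IsUnit (2 : R)) (h : -1 = u ^ 2 + v ^ 2)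
    (hXY : ⁅X, Y⁆ = -1) : Ideal.span {intertwiner u v X Y 0 0,
      intertwiner u v (conjGL (quatJ R) X) (conjGL (quatJ R) Y) 0 0} = ⊤ := by
  have hXY' : ⁅conjGL (quatJ R) X, conjGL (quatJ R) Y⁆ = -1 := by
    rw [← map_commutatorElement, hXY, conjGL_neg_one]
  obtain ⟨j, hj⟩ := h2.exists_right_inv
  have coprime : IsCoprime (intertwiner u v X Y 1 1)
      (intertwiner u v (conjGL (quatJ R) X) (conjGL (quatJ R) Y) 1 1) :=
    ⟨j, j, by linear_combination j * intertwiner_one_one_add h2 hXY + hj⟩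
  rw [Ideal.eq_top_iff_one, Ideal.mem_span_pair]
  exact (coprime.pow.of_isCoprime_of_dvd_left (intertwiner_dvd_sq h2 h hXY))
    |>.of_isCoprime_of_dvd_right (intertwiner_dvd_sq h2 h hXY')

lemma eq_conjGL_of_intertwiner_eq_smul (h2 : IsUnit (2 : R)) (h : -1 = u ^ 2 + v ^ 2)
    (hXY : ⁅X, Y⁆ = -1) {f : R} (hf : IsUnit f) {Q : GL (Fin 2) R}
    (hQ : intertwiner u v X Y = f • Q.1) :
    X = conjGL Q (quatI u v h) ∧ Y = conjGL Q (quatJ R) := by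
  obtain ⟨hX, hY⟩ := mul_intertwiner h2 h hXY
  rw [hQ, mul_smul_comm, smul_mul_assoc, hf.smul_left_cancel] at hX hY
  exact ⟨(conjGL_eq_iff.2 hX.symm).symm, (conjGL_eq_iff.2 hY.symm).symm⟩

lemma exists_intertwiner_eq_smul (h2 : IsUnit (2 : R)) (h : -1 = u ^ 2 + v ^ 2) {x : Fin 3 → R}
    (hx : IsUnit (x 2 - x 0 * x 1)) : ∃ X Y : SL(2, R), ⁅X, Y⁆ = -1 ∧ ∃ f : R, IsUnit f ∧
      intertwiner u v X Y = f • !![1, x 0; x 1, x 2] := by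
  let Q : GL (Fin 2) R := GeneralLinearGroup.mk'' !![1, x 0; x 1, x 2] (by
    rwa [det_fin_two_of, one_mul])
  have hQ : Q⁻¹.1 * !![1, x 0; x 1, x 2] = 1 := Units.inv_mul Q
  have entry₁₀ := congrFun₂ hQ 1 0
  have entry₁₁ := congrFun₂ hQ 1 1
  rw [Matrix.mul_apply, Fin.sum_univ_two] at entry₁₀ entry₁₁
  change _ * 1 + _ * x 1 = 0 at entry₁₀
  change _ * x 0 + _ * x 2 = 1 at entry₁₁
  have inv_det : Q⁻¹.1 1 1 * (x 2 - x 0 * x 1) = 1 := by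
    linear_combination entry₁₁ - x 0 * entry₁₀
  exact ⟨conjGL Q (quatI u v h), conjGL Q (quatJ R),
    by rw [← map_commutatorElement, commutator_quatI_quatJ, conjGL_neg_one],
    2 * Q⁻¹.1 1 1, h2.mul (.of_mul_eq_one _ inv_det), intertwiner_conjGL h Q⟩

end Quaternion

section NegOneVariety

open Matrix MvPolynomial
open scoped commutatorElement

variable {k : Type u} [Field k] {R : Type*} [CommRing R] [Algebra k R]

lemma map_algebraMap_neg_one : SpecialLinearGroup.map (algebraMap k R) (-1 : SL(2, k)) = -1 := by
  ext i j
  fin_cases i <;> fin_cases j <;> simp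

lemma commutator_pointX_pointY_neg_one (φ : Coord (-1 : SL(2, k)) →ₐ[k] R) :
    ⁅pointX φ, pointY φ⁆ = -1 := by
  rw [commutator_pointX_pointY, map_algebraMap_neg_one]

/-- The intertwiner of the standard pair with the universal point of `S_{-1}`. -/
noncomputable def univIntertwiner (a b : k) :
    Matrix (Fin 2) (Fin 2) (Coord (-1 : SL(2, k))) :=
  intertwiner (algebraMap k _ a) (algebraMap k _ b) (univX _) (univY _)

lemma apply_univIntertwiner (φ : Coord (-1 : SL(2, k)) →ₐ[k] R) (a b : k) (i j : Fin 2) :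
    φ (univIntertwiner a b i j) =
      intertwiner (algebraMap k R a) (algebraMap k R b) (pointX φ) (pointY φ) i j := by
  have entry_X (i j) : φ (univX _ i j) = pointX φ i j := rfl
  have entry_Y (i j) : φ (univY _ i j) = pointY φ i j := rfl
  rw [univIntertwiner, intertwiner_eq, intertwiner_eq]
  fin_cases i <;> fin_cases j <;> simp [mul_entry, entry_X, entry_Y]

lemma map_quatJ : GeneralLinearGroup.map (algebraMap k R) (quatJ k : GL (Fin 2) k) = quatJ R := by
  ext i j
  simp only [GeneralLinearGroup.map_apply, SpecialLinearGroup.coe_GL_coe_matrix]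
  fin_cases i <;> fin_cases j <;> simp [quatJ]

lemma neg_one_eq_algebraMap_sq_add {a b : k} (h : -1 = a ^ 2 + b ^ 2) :
    -1 = algebraMap k R a ^ 2 + algebraMap k R b ^ 2 := by
  rw [← map_pow, ← map_pow, ← map_add, ← h, map_neg, map_one]

lemma intertwiner_eq_smul_of_chart {a b : k} {φ : Coord (-1 : SL(2, k)) →ₐ[k] R} {x : Fin 3 → R}
    (hx : ∀ i, φ (![univIntertwiner a b 0 1, univIntertwiner a b 1 0, univIntertwiner a b 1 1] i) =
      x i * φ (univIntertwiner a b 0 0)) :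
    intertwiner (algebraMap k R a) (algebraMap k R b) (pointX φ) (pointY φ) =
      φ (univIntertwiner a b 0 0) • !![1, x 0; x 1, x 2] := by
  ext i j
  rw [← apply_univIntertwiner, Matrix.smul_apply, smul_eq_mul, mul_comm]
  fin_cases i <;> fin_cases j
  exacts [(one_mul _).symm, hx 0, hx 1, hx 2]

lemma isUnit_of_chart (h2 : (2 : k) ≠ 0) {a b : k} (h : -1 = a ^ 2 + b ^ 2)
    {φ : Coord (-1 : SL(2, k)) →ₐ[k] R} {x : Fin 3 → R}
    (hφ : IsUnit (φ (univIntertwiner a b 0 0)))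
    (hx : ∀ i, φ (![univIntertwiner a b 0 1, univIntertwiner a b 1 0, univIntertwiner a b 1 1] i) =
      x i * φ (univIntertwiner a b 0 0)) : IsUnit (x 2 - x 0 * x 1) := by
  have hdet := det_intertwiner (isUnit_two h2) (neg_one_eq_algebraMap_sq_add h)
    (commutator_pointX_pointY_neg_one φ)
  rw [← apply_univIntertwiner, intertwiner_eq_smul_of_chart hx, det_smul, det_fin_two_of,
    Fintype.card_fin, one_mul] at hdet
  have hmul : φ (univIntertwiner a b 0 0) * (x 2 - x 0 * x 1) = 2 :=
    hφ.mul_left_cancel (by linear_combination hdet)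
  exact isUnit_of_dvd_unit ⟨_, (mul_comm _ _).trans hmul |>.symm⟩ (isUnit_two h2)

lemma isChart_univIntertwiner (h2 : (2 : k) ≠ 0) {a b : k} (h : -1 = a ^ 2 + b ^ 2) :
    IsChart (k := k) (n := 3) (univIntertwiner a b 0 0) (univIntertwiner a b 0 0)
      ![univIntertwiner a b 0 1, univIntertwiner a b 1 0, univIntertwiner a b 1 1]
      (X 2 - X 0 * X 1) where
  den_dvd := dvd_rfl
  exists_point x hx := by
    rw [map_sub, map_mul, aeval_X, aeval_X, aeval_X] at hx
    obtain ⟨X, Y, hXY, f, hf, hP⟩ := exists_intertwiner_eq_smul (isUnit_two h2)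
      (neg_one_eq_algebraMap_sq_add h) hx
    let φ : Coord (-1 : SL(2, k)) →ₐ[k] _ := point X Y (hXY.trans map_algebraMap_neg_one.symm)
    have apply (i j) : φ (univIntertwiner a b i j) = f * !![1, x 0; x 1, x 2] i j := by
      rw [apply_univIntertwiner, pointX_point, pointY_point, hP, Matrix.smul_apply, smul_eq_mul]
    have apply₀₀ : φ (univIntertwiner a b 0 0) = f := (apply 0 0).trans (mul_one f)
    refine ⟨φ, apply₀₀.symm ▸ hf, ?_⟩
    rw [apply₀₀]
    refine Fin.forall_fin_succ.2 ⟨?_, Fin.forall_fin_two.2 ⟨?_, ?_⟩⟩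
    exacts [(apply 0 1).trans (mul_comm _ _), (apply 1 0).trans (mul_comm _ _),
      (apply 1 1).trans (mul_comm _ _)]
  isUnit_aeval φ x hφ hx := by
    rw [map_sub, map_mul, aeval_X, aeval_X, aeval_X]
    exact isUnit_of_chart h2 h hφ hx
  point_unique φ ψ x hφ hψ hφx hψx := by
    let Q : GL (Fin 2) _ := GeneralLinearGroup.mk'' !![1, x 0; x 1, x 2] (by
      rw [det_fin_two_of, one_mul]
      exact isUnit_of_chart h2 h hφ hφx)
    obtain ⟨hXφ, hYφ⟩ := eq_conjGL_of_intertwiner_eq_smul (isUnit_two h2)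
      (neg_one_eq_algebraMap_sq_add h) (commutator_pointX_pointY_neg_one φ) hφ (Q := Q)
      (intertwiner_eq_smul_of_chart hφx)
    obtain ⟨hXψ, hYψ⟩ := eq_conjGL_of_intertwiner_eq_smul (isUnit_two h2)
      (neg_one_eq_algebraMap_sq_add h) (commutator_pointX_pointY_neg_one ψ) hψ (Q := Q)
      (intertwiner_eq_smul_of_chart hψx)
    exact point_ext (hXφ.trans hXψ.symm) (hYφ.trans hYψ.symm)

variable (k) in
/-- The automorphism of `S_{-1}` that conjugates both matrices by `quatJ`. -/
noncomputable def conjQuatJ : Coord (-1 : SL(2, k)) ≃ₐ[k] Coord (-1 : SL(2, k)) :=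
  conjEquiv (quatJ k) (conjGL_neg_one _)

lemma apply_conjQuatJ_univIntertwiner (φ : Coord (-1 : SL(2, k)) →ₐ[k] R) (a b : k)
    (i j : Fin 2) : φ (conjQuatJ k (univIntertwiner a b i j)) =
      intertwiner (algebraMap k R a) (algebraMap k R b) (conjGL (quatJ R) (pointX φ))
        (conjGL (quatJ R) (pointY φ)) i j := by
  have := apply_univIntertwiner (φ.comp (conjHom (quatJ k) (conjGL_neg_one _))) a b i j
  rwa [pointX_comp_conjHom, pointY_comp_conjHom, map_quatJ] at this

lemma image_univIntertwiner (φ : Coord (-1 : SL(2, k)) →ₐ[k] R) (a b : k) :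
    (fun τ : Coord (-1 : SL(2, k)) ≃ₐ[k] Coord (-1 : SL(2, k)) =>
      φ (τ (univIntertwiner a b 0 0))) '' {AlgEquiv.refl, conjQuatJ k} =
    {intertwiner (algebraMap k R a) (algebraMap k R b) (pointX φ) (pointY φ) 0 0,
      intertwiner (algebraMap k R a) (algebraMap k R b) (conjGL (quatJ R) (pointX φ))
        (conjGL (quatJ R) (pointY φ)) 0 0} := by
  rw [Set.image_pair, apply_conjQuatJ_univIntertwiner, AlgEquiv.coe_refl, id_eq,
    apply_univIntertwiner]

lemma isRationalDomain_neg_one (h2 : (2 : k) ≠ 0) (h : ∃ a b : k, -1 = a ^ 2 + b ^ 2) :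
    IsRationalDomain k (Coord (-1 : SL(2, k))) 3 := by
  obtain ⟨a, b, h⟩ := h
  refine (isChart_univIntertwiner h2 h).isRationalDomain (T := {AlgEquiv.refl, conjQuatJ k})
    ?_ ?_ ?_
  · exact fun h => by simpa using congrArg (eval ![0, 0, 1]) h
  · exact (congrArg Ideal.span
      (image_univIntertwiner (AlgHom.id k (Coord (-1 : SL(2, k)))) a b)).trans
      (span_intertwiner_eq_top (isUnit_two h2) (neg_one_eq_algebraMap_sq_add h)
        (commutator_pointX_pointY_neg_one _))
  · rintro D _ _ _ φ x independent hφ hx τ (rfl | rfl)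
    · exact hφ.ne_zero
    intro h₀₀
    rw [apply_conjQuatJ_univIntertwiner] at h₀₀
    have hsq := intertwiner_one_zero_sq (isUnit_two h2) (neg_one_eq_algebraMap_sq_add h)
      (commutator_pointX_pointY_neg_one φ)
    have h₁₀ : φ (univIntertwiner a b 1 0) = x 1 * φ (univIntertwiner a b 0 0) := hx 1
    rw [h₀₀, mul_zero, ← apply_univIntertwiner, h₁₀] at hsq
    exact pow_ne_zero 2 (mul_ne_zero (independent.ne_zero 1) hφ.ne_zero) hsq

end NegOneVariety

section RationalPoints

open Matrix
open scoped commutatorElement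

variable {k : Type u} [Field k]

lemma nonempty_algHom_of_ratPoint {α : SL(2, k)} (p : RatPoint (structureMap α)) :
    Nonempty (Coord α →ₐ[k] k) := by
  obtain ⟨p, hp⟩ := p
  let q : CommRingCat.of (CoordRing α) ⟶ CommRingCat.of k := Spec.preimage p
  have hq : CommRingCat.ofHom (algebraMap k (CoordRing α)) ≫ q = 𝟙 _ := by
    apply Spec.map_injective
    rw [Spec.map_comp, Spec.map_id, show Spec.map q = p from Spec.map_preimage p]
    exact hp
  let φ : CoordRing α →ₐ[k] k :=
    { __ := q.hom
      commutes' := fun x => congrArg (fun g => g.hom x) hq }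
  exact ⟨φ.comp (coordEquiv α).toAlgHom⟩

lemma exists_sq_add_sq_of_commutator_eq_neg_one (h2 : (2 : k) ≠ 0) {X Y : SL(2, k)}
    (hXY : ⁅X, Y⁆ = -1) : ∃ a b : k, -1 = a ^ 2 + b ^ 2 := by
  obtain ⟨hX₁₁, hY₁₁, hXY⟩ := entries_of_commutator_eq_neg_one h2.isUnit hXY
  have hX := det_entries X
  have hY := det_entries Y
  rw [hX₁₁] at hX
  rw [hY₁₁] at hY
  by_cases hX₁₀ : X 1 0 = 0
  · exact ⟨X 0 0, 0, by linear_combination hX + X 0 1 * hX₁₀⟩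
  · refine ⟨(X 1 0 * Y 0 0 - X 0 0 * Y 1 0) / X 1 0, Y 1 0 / X 1 0, ?_⟩
    field_simp
    linear_combination Y 1 0 ^ 2 * hX + X 1 0 ^ 2 * hY + X 1 0 * Y 1 0 * hXY

lemma charZero_of_neg_one_ne_sq_add_sq (h : ¬ ∃ a b : k, -1 = a ^ 2 + b ^ 2) : CharZero k := by
  obtain ⟨p, hp⟩ := CharP.exists k
  rcases CharP.char_is_prime_or_zero k p with hprime | rfl
  · have : NeZero p := ⟨hprime.ne_zero⟩
    obtain ⟨a, b, hab⟩ := CharP.sq_add_sq k p (-1)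
    exact absurd ⟨a, b, by simpa using hab.symm⟩ h
  · exact CharP.charP_to_charZero k

lemma isEmpty_ratPoint_neg_one (h : ¬ ∃ a b : k, -1 = a ^ 2 + b ^ 2) :
    IsEmpty (RatPoint (structureMap (-1 : SL(2, k)))) := by
  have := charZero_of_neg_one_ne_sq_add_sq h
  refine ⟨fun p => h ?_⟩
  obtain ⟨φ⟩ := nonempty_algHom_of_ratPoint p
  exact exists_sq_add_sq_of_commutator_eq_neg_one two_ne_zero (commutator_pointX_pointY_neg_one φ)

lemma not_isRationalOver_neg_one (h : ¬ ∃ a b : k, -1 = a ^ 2 + b ^ 2) :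
    ¬ Scheme.IsRationalOver (structureMap (-1 : SL(2, k))) := by
  have := charZero_of_neg_one_ne_sq_add_sq h
  intro hrat
  exact not_isEmpty_iff.2 (nonempty_ratPoint_of_isRationalOver hrat) (isEmpty_ratPoint_neg_one h)

end RationalPoints

section Main

variable {k : Type u} [Field k]

lemma isRationalOfDim_neg_one (h2 : (2 : k) ≠ 0) (h : ∃ a b : k, -1 = a ^ 2 + b ^ 2) :
    IsRationalOfDim (structureMap (-1 : SL(2, k))) 3 :=
  ((isRationalDomain_neg_one h2 h).of_algEquiv (coordEquiv _)).isRationalOfDim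

lemma isRationalOfDim_of_trace_eq_two {α : SL(2, k)} (hα : α ∉ Subgroup.center SL(2, k))
    (htr : α.1.trace = 2) : IsRationalOfDim (structureMap α) 3 := by
  obtain ⟨P, hP⟩ := exists_conjGL_jordan hα (one_mul 1) one_ne_zero (htr.trans (mul_one 2).symm)
  exact ((isRationalDomain_unipotent.of_algEquiv (conjEquiv P hP).symm).of_algEquiv
    (coordEquiv α)).isRationalOfDim

lemma isRationalOfDim_of_trace_eq_neg_two {α : SL(2, k)} (hα : α ∉ Subgroup.center SL(2, k))
    (htr : α.1.trace = -2) : IsRationalOfDim (structureMap α) 3 := by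
  by_cases h2 : (2 : k) = 0
  · exact isRationalOfDim_of_trace_eq_two hα (by rw [htr, h2, neg_zero])
  obtain ⟨P, hP⟩ := exists_conjGL_jordan hα (ε := -1) (m := -2) (by rw [neg_mul_neg, one_mul])
    (neg_ne_zero.2 h2) (by rw [htr, mul_neg_one])
  exact (((isRationalDomain_negJordan h2).of_algEquiv (conjEquiv P hP).symm).of_algEquiv
    (coordEquiv α)).isRationalOfDim

end Main

end CommutatorVariety

open CommutatorVariety in
theorem mainTheorem5_general {k : Type*} [Field k] :
    ((2 : k) ≠ 0 → (∃ a b : k, -1 = a ^ 2 + b ^ 2) →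
      IsRationalOfDim (structureMap (-1 : SL(2, k))) 3) ∧
    ((¬ ∃ a b : k, -1 = a ^ 2 + b ^ 2) →
      IsEmpty (RatPoint (structureMap (-1 : SL(2, k)))) ∧
      ¬ Scheme.IsRationalOver (structureMap (-1 : SL(2, k)))) ∧
    (∀ α : SL(2, k), α ∉ Subgroup.center SL(2, k) → α.1.trace = 2 ∨ α.1.trace = -2 →
      IsRationalOfDim (structureMap α) 3) :=
  ⟨isRationalOfDim_neg_one,
    fun h => ⟨isEmpty_ratPoint_neg_one h, not_isRationalOver_neg_one h⟩,
    fun _ hα htr => htr.elim (isRationalOfDim_of_trace_eq_two hα)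
      (isRationalOfDim_of_trace_eq_neg_two hα)⟩

theorem mainTheorem5 {k : Type*} [Field k] [CharZero k] :
    ((∃ a b : k, -1 = a ^ 2 + b ^ 2) →
      CommutatorVariety.IsRationalOfDim
        (CommutatorVariety.structureMap (-1 : Matrix.SpecialLinearGroup (Fin 2) k)) 3) ∧
    ((¬ ∃ a b : k, -1 = a ^ 2 + b ^ 2) →
      IsEmpty (CommutatorVariety.RatPoint
        (CommutatorVariety.structureMap (-1 : Matrix.SpecialLinearGroup (Fin 2) k))) ∧
      ¬ AlgebraicGeometry.Scheme.IsRationalOver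
        (CommutatorVariety.structureMap (-1 : Matrix.SpecialLinearGroup (Fin 2) k))) ∧
    (∀ α : Matrix.SpecialLinearGroup (Fin 2) k,
      α ∉ Subgroup.center (Matrix.SpecialLinearGroup (Fin 2) k) →
      (α : Matrix (Fin 2) (Fin 2) k).trace = 2 ∨ (α : Matrix (Fin 2) (Fin 2) k).trace = -2 →
      CommutatorVariety.IsRationalOfDim (CommutatorVariety.structureMap α) 3) := by
  obtain ⟨neg_one, rest⟩ := mainTheorem5_general (k := k)
  exact ⟨neg_one two_ne_zero, rest⟩
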